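/- \textbf{Setting.} Let $P=\mathbb R^D$ be energy-momentum space (any $D$). A theory (one real field, arbitrary interaction) is given by Feynman rules with vertices of two types, $+$ and $-$: for each kind $t$ of interaction term, of valence $d_t$, and each type $a=\pm1$ a symmetric function $V_t^a(x_1,\dots,x_{d_t})$ of the momenta entering the vertex, and propagators $G_{ab}(q)$ with $G_{ab}(-q)=G_{ba}(q)$, where $q$ enters the end of type $a$ and $-q$ the end of type $b$. Neither Lorentz invariance nor locality is assumed. Propagators containing $\delta$-functions or $i0$ are understood through their regularizations ($i0\to i\eta$, $\eta>0$, and $\delta(x)\to\frac1{2\pi i}(\frac1{x-i\eta}-\frac1{x+i\eta})$), so the $G_{ab}$ are functions; the identities below hold for each such choice, that is, for each $\eta$. A \emph{diagram} for $\hat G_n(p_1,\epsilon_1,\dots,p_n,\epsilon_n)$ is a connected amputated Feynman diagram with $n$ external legs, the $i$-th one attached to a vertex of type $\epsilon_i$ and carrying the incoming momentum $p_i$. It contributes the product of its symmetry factor $1/|\mathrm{Aut}|$, the overall factor $\delta(p_1+\dots+p_n)$, the coupling constant $g_t$ of each vertex, and the integral over independent loop momenta of the product of all vertices and propagators, momentum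 being conserved at each vertex (an integral that does not converge absolutely is given the value $0$). Propagators are the full (renormalized) ones; accordingly diagrams have no self-energy insertions, that is, there is no non-empty connected set of vertices which exactly two half-edges (external legs or halves of edges to other vertices) leave. $\hat G_n$ is the sum of all these diagrams, a formal power series in the couplings $g_t$; its momenta need not be on shell. \textbf{Lemma 1.} Let $1\le k\le n-1$. The sum of all diagrams for $\hat G_n(p_1,\epsilon_1,\dots,p_n,\epsilon_n)$ which contain a $++$ edge (an edge joining two $+$ vertices) separating $p_1,\dots,p_k$ from $p_{k+1},\dots,p_n$ (its removal leaves two components, one with the legs $1,\dots,k$ and the other with the legs $k+1,\dots,n$) is equal, in each order in the couplings, to $$\int dq\,G_{++}(q)\,\hat G_{k+1}(p_1,\epsilon_1,\dots,p_k,\epsilon_k,q,+1)\,\hat G_{n-k+1}(p_{k+1},\epsilon_{k+1},\dots,p_n,\epsilon_n,-q,+1).$$ Here the coefficients of $\delta(p_1+\dots+p_n)$ are equal at every point with $p_1+\dots+p_n=0$; on the right the two factors $\delta(p_1+\dots+p_k+q)$ and $\delta(p_{k+1}+\dots+p_n-q)$ give $\delta(p_1+\dots+p_n)$ and put $q=-(p_1+\dots+p_k)$.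 The same formula holds if self-energy insertions are allowed in all diagrams, provided that on the left each diagram is counted as many times as it has such separating $++$ edges. -/

import Mathlib

open MeasureTheory
open scoped Nat

noncomputable section

namespace GGreen

/-- Energy-momentum space in `D` dimensions, with Lebesgue measure. -/
abbrev Momentum (D : ℕ) : Type := Fin D → ℝ

/-- The Feynman rules of a theory of one (real) field with `+` and `-` vertices; the labels
`+`, `-` are the elements `1`, `-1` of `ℤˣ`. `κ` indexes the interaction terms (each with its
own formal coupling constant).

* `vertex t a` is the factor of a vertex of kind `t` and type `a`, as a function of the momenta
  entering it; the conservation law at the vertex is not part of it (see `Diagram.Conserves`).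
* `propagator a b q` is the factor of an edge joining a vertex of type `a` to one of type `b`,
  where the momentum `q` enters the vertex of type `a` and `-q` enters the vertex of type `b`.

Neither Lorentz invariance nor locality is required. Propagators such as `i / (p² - m² + i0)`
and `2π θ(∓ω) δ(p² - m²)` enter through their regularizations, with `i0` replaced by `iη`,
`η > 0`, and `δ(x)` by `(2πi)⁻¹ (1 / (x - iη) - 1 / (x + iη))`. -/
structure Theory (κ : Type*) (D : ℕ) where
  valence : κ → ℕ
  vertex : (t : κ) → ℤˣ → (Fin (valence t) → Momentum D) → ℂ
  vertex_symm : ∀ t a (σ : Equiv.Perm (Fin (valence t))) x, vertex t a (x ∘ σ) = vertex t a x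
  propagator : ℤˣ → ℤˣ → Momentum D → ℂ
  propagator_symm : ∀ a b q, propagator a b (-q) = propagator b a q

/-- The (labelled) vertices of a diagram which has `m t` vertices of each kind `t`. -/
abbrev Vert {κ : Type*} (m : κ →₀ ℕ) : Type _ := (t : m.support) × Fin (m t)

/-- The half-edges: a vertex of kind `t` has `d t` of them. -/
abbrev Half {κ : Type*} (d : κ → ℕ) (m : κ →₀ ℕ) : Type _ := (v : Vert m) × Fin (d v.1)

/-- Amputated diagrams with labelled vertices, labelled half-edges and `n` external legs.
`pair` exchanges the two halves of every internal edge and fixes exactly the half-edges that are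
external legs; the `i`-th leg is attached to a vertex of type `ε i`. -/
structure Diagram {κ : Type*} (d : κ → ℕ) (m : κ →₀ ℕ) {n : ℕ} (ε : Fin n → ℤˣ) where
  sign : Vert m → ℤˣ
  pair : Half d m → Half d m
  leg : Fin n → Half d m
  pair_pair : ∀ h, pair (pair h) = h
  leg_injective : Function.Injective leg
  pair_eq_iff : ∀ h, pair h = h ↔ h ∈ Set.range leg
  sign_leg : ∀ i, sign (leg i).1 = ε i

namespace Diagram

variable {κ : Type*} {d : κ → ℕ} {m : κ →₀ ℕ} {n : ℕ} {ε : Fin n → ℤˣ}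

instance : Finite (Diagram d m ε) :=
  Finite.of_injective
    (fun X : Diagram d m ε => (X.sign, X.pair, X.leg))
    (by
      rintro ⟨s, q, l, _, _, _, _⟩ ⟨s', q', l', _, _, _, _⟩ h
      simp only [Prod.mk.injEq] at h
      obtain ⟨rfl, rfl, rfl⟩ := h
      rfl)

instance : Fintype (Diagram d m ε) := Fintype.ofFinite _

/-- The graph on the vertices that is left when the half-edges in `C` are removed. -/
def graph (X : Diagram d m ε) (C : Set (Half d m)) : SimpleGraph (Vert m) :=
  SimpleGraph.fromRel fun v w => ∃ h, h ∉ C ∧ h.1 = v ∧ (X.pair h).1 = w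

/-- The diagram is connected. -/
def Connected (X : Diagram d m ε) : Prop := (X.graph ∅).Connected

/-- The half-edges leaving a set `U` of vertices: external legs attached to `U`, and halves of
edges that join `U` to its complement. -/
def boundary (X : Diagram d m ε) (U : Set (Vert m)) : Set (Half d m) :=
  {h | h.1 ∈ U ∧ (X.pair h = h ∨ (X.pair h).1 ∉ U)}

/-- No part of the diagram is a self-energy (two-point) insertion. -/
def NoSelfEnergy (X : Diagram d m ε) : Prop :=
  ¬ ∃ U : Set (Vert m), ((X.graph ∅).induce U).Connected ∧ (X.boundary U).ncard = 2

/-- `h` and `X.pair h` are the halves of a `++` edge whose removal disconnects the diagram in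
such a way that the first `k` legs lie on the side of `h` and the last `l` legs on the side of
`X.pair h`. -/
def Separates {k l : ℕ} {ε : Fin (k + l) → ℤˣ} (X : Diagram d m ε) (h : Half d m) : Prop :=
  X.pair h ≠ h ∧ X.sign h.1 = 1 ∧ X.sign (X.pair h).1 = 1 ∧
  ¬ (X.graph {h, X.pair h}).Reachable h.1 (X.pair h).1 ∧
  (∀ i : Fin k, (X.graph {h, X.pair h}).Reachable h.1 (X.leg (Fin.castAdd l i)).1) ∧
  ∀ j : Fin l, (X.graph {h, X.pair h}).Reachable (X.pair h).1 (X.leg (Fin.natAdd k j)).1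

/-- `x h` is the momentum entering the vertex of `h` through `h`. It is prescribed on the
external legs, the two ends of an internal edge carry opposite momenta, and momentum is
conserved at each vertex. -/
def Conserves {A : Type*} [AddCommGroup A] (X : Diagram d m ε) (p : Fin n → A)
    (x : Half d m → A) : Prop :=
  (∀ i, x (X.leg i) = p i) ∧ (∀ h, X.pair h ≠ h → x (X.pair h) = - x h) ∧
  ∀ v, ∑ s, x ⟨v, s⟩ = 0

/-- `L` is a choice of independent loop momenta: whatever the (conserved) external momenta are,
the momenta in `L` can be prescribed freely and then the conservation laws determine all others.
For a connected diagram this means that `L` consists of one half of each internal edge outside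
some spanning tree. -/
def IsLoopBasis (X : Diagram d m ε) (L : Set (Half d m)) : Prop :=
  ∀ (A : Type) [AddCommGroup A] (p : Fin n → A), ∑ i, p i = 0 →
    ∀ y : L → A, ∃! x : Half d m → A, X.Conserves p x ∧ ∀ h : L, x h = y h

open Classical in
/-- The internal edges. -/
def edges (X : Diagram d m ε) : Finset (Sym2 (Half d m)) :=
  (Finset.univ.filter fun h => X.pair h ≠ h).image fun h => s(h, X.pair h)

end Diagram

namespace Theory

variable {κ : Type*} {D : ℕ} (T : Theory κ D) {m : κ →₀ ℕ} {n : ℕ} {ε : Fin n → ℤˣ}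

/-- The factor of an edge. It is computed from an arbitrary one of the two ends, the choice
being immaterial by `propagator_symm`. -/
def edgeFactor (X : Diagram T.valence m ε) (x : Half T.valence m → Momentum D)
    (e : Sym2 (Half T.valence m)) : ℂ :=
  T.propagator (X.sign (Quot.out e).1.1) (X.sign (X.pair (Quot.out e).1).1) (x (Quot.out e).1)

/-- The integrand of a diagram: the product of its vertices and propagators. -/
def integrand (X : Diagram T.valence m ε) (x : Half T.valence m → Momentum D) : ℂ :=
  (∏ v : Vert m, T.vertex v.1 (X.sign v) fun s => x ⟨v, s⟩) * ∏ e ∈ X.edges, T.edgeFactor X x e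

open Classical in
/-- The Feynman integral of a diagram over independent loop momenta, without the factor
`δ(p₁ + ⋯ + pₙ)` (so that `p` is meant to obey the conservation law). -/
def value (X : Diagram T.valence m ε) (p : Fin n → Momentum D) : ℂ :=
  if hL : ∃ L, X.IsLoopBasis L then
    ∫ y : hL.choose → Momentum D,
      if hx : ∃ x : Half T.valence m → Momentum D,
          X.Conserves p x ∧ ∀ h : hL.choose, x h = y h then
        T.integrand X hx.choose
      else 0
  else 0

/-- The number of labellings, `∏ₜ mₜ! (dₜ!) ^ mₜ`. Summing over labelled diagrams and dividing by
it is summing over diagrams `Γ` up to isomorphism with the factor `1 / |Aut Γ|`. -/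
def labellings (m : κ →₀ ℕ) : ℂ := m.prod fun t j => ((j ! * (T.valence t)! ^ j : ℕ) : ℂ)

/-- Sum of all diagrams with `m t` vertices of each kind `t`, the diagram `X` counted with
multiplicity `w X`. -/
def diagramSum (p : Fin n → Momentum D) (w : Diagram T.valence m ε → ℕ) : ℂ :=
  (∑ X : Diagram T.valence m ε, (w X : ℂ) * T.value X p) / T.labellings m

open Classical in
/-- The connected amputated GGreen function in the technique where propagators are the full ones
(so that diagrams have no self-energy insertions), as a formal power series in the couplings. -/
def green (ε : Fin n → ℤˣ) (p : Fin n → Momentum D) : MvPowerSeries κ ℂ := fun m =>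
  T.diagramSum p fun X : Diagram T.valence m ε => if X.Connected ∧ X.NoSelfEnergy then 1 else 0

open Classical in
/-- The part of `green` coming from the diagrams that contain a `++` edge separating the first
`k` legs from the last `l` legs. -/
def greenSep {k l : ℕ} (ε : Fin (k + l) → ℤˣ) (p : Fin (k + l) → Momentum D) :
    MvPowerSeries κ ℂ := fun m =>
  T.diagramSum p fun X : Diagram T.valence m ε =>
    if X.Connected ∧ X.NoSelfEnergy ∧ ∃ h, X.Separates h then 1 else 0

open Classical in
/-- The sum of all connected amputated diagrams, self-energy insertions included. -/
def greenAll (ε : Fin n → ℤˣ) (p : Fin n → Momentum D) : MvPowerSeries κ ℂ := fun m =>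
  T.diagramSum p fun X : Diagram T.valence m ε => if X.Connected then 1 else 0

open Classical in
/-- The sum over all connected amputated diagrams, self-energy insertions included, and over all
`++` edges in them that separate the first `k` legs from the last `l` legs. -/
def greenAllSep {k l : ℕ} (ε : Fin (k + l) → ℤˣ) (p : Fin (k + l) → Momentum D) :
    MvPowerSeries κ ℂ := fun m =>
  T.diagramSum p fun X : Diagram T.valence m ε =>
    if X.Connected then {h | X.Separates h}.ncard else 0

end Theory

end GGreen

end

/-! Cutting a separating `++` edge turns a diagram into a pair of diagrams, each with one extra leg
of type `+`; joining the two extra legs undoes the cut. Three things have to match under this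
correspondence.

Diagrams: a pair (diagram, separating half-edge) whose near side has vertex set `A` is the same as a
pair of diagrams on `A` and on its complement (`sum_separates`). Connectedness passes both ways. So
does the absence of self-energy insertions (`IsGlue.noSelfEnergy_iff`): a connected set containing
both ends of the joining edge is left, in each part, by the joining leg and by at least two other
half-edges, hence by at least four in the whole. The separating half-edge is oriented towards the
first `k` legs, so each separating edge is counted once. Without self-energy insertions there is at
most one such edge, because the piece between two of them would be left by exactly two half-edges
(`Wiring.NoSelfEnergy.separates_unique`).

Integrals: the joining edge is a bridge, so its momentum is fixed by the external ones and loop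
momenta of the parts together are loop momenta of the whole. The integrand is `G 1 1` at that
momentum times a product of functions of separate variables (`IsGlue.value_eq`). The definition of
the integral chooses some loop basis; a change of basis is an integral linear map with integral
inverse, so it preserves volume (`Wiring.loopIntegral_congr`).

Symmetry factors: the number of sets `A` with prescribed numbers of vertices of each kind is a
product of binomial coefficients, which is the ratio of the numbers of labellings
(`Theory.card_mul_labellings`). Summing over `A` therefore gives the coefficient of a product of
power series.

Both formulas are proved at once in `Theory.sum_ncard_separates_div`, where a proposition `P` says
whether self-energy insertions are excluded. -/

noncomputable section

/-! ### Separating edges, and their uniqueness in the absence of self-energy insertions -/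

namespace GGreen

/-- A diagram on an arbitrary system of half-edges: `r h` is the vertex to which `h` is
attached. The remaining data are those of `Diagram`. -/
@[ext]
structure Wiring {V H : Type*} (r : H → V) {n : ℕ} (ε : Fin n → ℤˣ) where
  sign : V → ℤˣ
  pair : H → H
  leg : Fin n → H
  pair_pair : ∀ h, pair (pair h) = h
  leg_injective : Function.Injective leg
  pair_eq_iff : ∀ h, pair h = h ↔ h ∈ Set.range leg
  sign_leg : ∀ i, sign (r (leg i)) = ε i

namespace Wiring

variable {V H : Type*} {r : H → V} {n : ℕ} {ε : Fin n → ℤˣ}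

/-- The graph on the vertices that is left when the half-edges in `C` are removed. -/
def graph (X : Wiring r ε) (C : Set H) : SimpleGraph V :=
  SimpleGraph.fromRel fun v w => ∃ h, h ∉ C ∧ r h = v ∧ r (X.pair h) = w

/-- The diagram is connected. -/
def Connected (X : Wiring r ε) : Prop := (X.graph ∅).Connected

/-- The half-edges leaving a set of vertices. -/
def boundary (X : Wiring r ε) (U : Set V) : Set H :=
  {h | r h ∈ U ∧ (X.pair h = h ∨ r (X.pair h) ∉ U)}

/-- There is no connected set of vertices left by exactly two half-edges. -/
def NoSelfEnergy (X : Wiring r ε) : Prop :=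
  ¬ ∃ U : Set V, ((X.graph ∅).induce U).Connected ∧ (X.boundary U).ncard = 2

/-- `h` and `X.pair h` are the halves of a `++` edge whose removal separates the legs
`e (Sum.inl i)`, on the side of `h`, from the legs `e (Sum.inr j)`. -/
def Separates {k l : ℕ} (X : Wiring r ε) (e : Fin k ⊕ Fin l ≃ Fin n) (h : H) : Prop :=
  X.pair h ≠ h ∧ X.sign (r h) = 1 ∧ X.sign (r (X.pair h)) = 1 ∧
  ¬ (X.graph {h, X.pair h}).Reachable (r h) (r (X.pair h)) ∧
  (∀ i, (X.graph {h, X.pair h}).Reachable (r h) (r (X.leg (e (Sum.inl i))))) ∧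
  ∀ j, (X.graph {h, X.pair h}).Reachable (r (X.pair h)) (r (X.leg (e (Sum.inr j))))

/-- The side of `h` when the edge of `h` is removed. -/
def side (X : Wiring r ε) (h : H) : Set V :=
  {v | (X.graph {h, X.pair h}).Reachable (r h) v}

/-- The set `U` of vertices is connected: a non-empty part of `U` which no edge inside `U` leaves
is all of `U`. -/
def ConnectedOn (X : Wiring r ε) (U : Set V) : Prop :=
  U.Nonempty ∧ ∀ S : Set V, (S ∩ U).Nonempty →
    (∀ h, r h ∈ S → r h ∈ U → r (X.pair h) ∈ U → r (X.pair h) ∈ S) → U ⊆ S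

theorem pair_leg (X : Wiring r ε) (i : Fin n) : X.pair (X.leg i) = X.leg i :=
  (X.pair_eq_iff _).2 ⟨i, rfl⟩

theorem pair_injective (X : Wiring r ε) : Function.Injective X.pair :=
  Function.LeftInverse.injective X.pair_pair

/-- Replaces walks by invariant sets: the component of `v` is the smallest set containing `v` that
no remaining edge leaves. Closure of `C` under `pair` makes the remaining relation symmetric. -/
theorem reachable_iff (X : Wiring r ε) {C : Set H} (hC : ∀ h ∈ C, X.pair h ∈ C) {v w : V} :
    (X.graph C).Reachable v w ↔
      ∀ S : Set V, v ∈ S → (∀ h ∉ C, r h ∈ S → r (X.pair h) ∈ S) → w ∈ S := by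
  constructor
  · rintro ⟨p⟩ S hv hS
    induction p with
    | nil => exact hv
    | cons hadj _ ih =>
      refine ih ?_
      rw [graph, SimpleGraph.fromRel_adj] at hadj
      rcases hadj with ⟨-, ⟨h, hh, rfl, rfl⟩ | ⟨h, hh, rfl, rfl⟩⟩
      · exact hS h hh hv
      · have := hS (X.pair h) (fun h' => hh (by simpa [X.pair_pair] using hC _ h')) hv
        rwa [X.pair_pair] at this
  · intro H
    refine H {u | (X.graph C).Reachable v u} (SimpleGraph.Reachable.refl _) ?_
    intro h hh hv
    by_cases heq : r h = r (X.pair h)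
    · simpa [← heq] using hv
    · refine SimpleGraph.Reachable.trans hv (SimpleGraph.Adj.reachable ?_)
      rw [graph, SimpleGraph.fromRel_adj]
      exact ⟨heq, Or.inl ⟨h, hh, rfl, rfl⟩⟩

theorem induce_connected_iff (X : Wiring r ε) (U : Set V) :
    ((X.graph ∅).induce U).Connected ↔ X.ConnectedOn U := by
  constructor
  · intro hU
    refine ⟨Set.nonempty_coe_sort.1 hU.nonempty, ?_⟩
    rintro S ⟨v, hvS, hvU⟩ hS w hw
    obtain ⟨p⟩ := hU.preconnected ⟨v, hvU⟩ ⟨w, hw⟩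
    suffices ∀ (a b : U) (p : ((X.graph ∅).induce U).Walk a b), a.1 ∈ S → b.1 ∈ S from
      this _ _ p hvS
    intro a b p
    induction p with
    | nil => exact id
    | @cons a b c hadj _ ih =>
      intro ha
      refine ih ?_
      obtain ⟨a, ha'⟩ := a
      obtain ⟨b, hb'⟩ := b
      rw [SimpleGraph.comap_adj, graph, SimpleGraph.fromRel_adj] at hadj
      rcases hadj with ⟨-, ⟨h, -, rfl, rfl⟩ | ⟨h, -, rfl, rfl⟩⟩
      · exact hS h ha ha' hb'
      · have := hS (X.pair h) ha ha'
        rw [X.pair_pair] at this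
        exact this hb'
  · rintro ⟨⟨v, hv⟩, H⟩
    have key : ∀ a b : U, ((X.graph ∅).induce U).Reachable a b := by
      rintro ⟨a, ha⟩ ⟨b, hb⟩
      have := H {u | ∃ hu : u ∈ U, ((X.graph ∅).induce U).Reachable ⟨a, ha⟩ ⟨u, hu⟩}
        ⟨a, ⟨ha, SimpleGraph.Reachable.refl _⟩, ha⟩ ?_ hb
      · exact this.2
      · rintro h ⟨hu, hr⟩ - hp
        refine ⟨hp, ?_⟩
        by_cases heq : r h = r (X.pair h)
        · simpa [← heq] using hr
        · refine hr.trans (SimpleGraph.Adj.reachable ?_)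
          rw [SimpleGraph.comap_adj, graph, SimpleGraph.fromRel_adj]
          exact ⟨heq, Or.inl ⟨h, by simp, rfl, rfl⟩⟩
    have : Nonempty U := ⟨⟨v, hv⟩⟩
    exact ⟨key⟩

theorem connected_iff (X : Wiring r ε) : X.Connected ↔ X.ConnectedOn Set.univ := by
  rw [← induce_connected_iff]
  exact (SimpleGraph.induceUnivIso _).connected_iff.symm

theorem noSelfEnergy_iff (X : Wiring r ε) :
    X.NoSelfEnergy ↔ ∀ U, X.ConnectedOn U → (X.boundary U).ncard ≠ 2 := by
  simp only [NoSelfEnergy, induce_connected_iff, not_exists, not_and, ne_eq]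

theorem Connected.eq_univ {X : Wiring r ε} (hX : X.Connected) {S : Set V} (hS : S.Nonempty)
    (h : ∀ h, r h ∈ S → r (X.pair h) ∈ S) : S = Set.univ :=
  Set.eq_univ_of_univ_subset
    ((X.connected_iff.1 hX).2 S (by simpa using hS) fun g hg _ _ => h g hg)

theorem edge_closed (X : Wiring r ε) (h : H) :
    ∀ g ∈ ({h, X.pair h} : Set H), X.pair g ∈ ({h, X.pair h} : Set H) := by
  rintro g (rfl | rfl)
  · simp
  · simp [X.pair_pair]

theorem mem_side (X : Wiring r ε) {h : H} {v : V} :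
    v ∈ X.side h ↔ ∀ S : Set V, r h ∈ S →
      (∀ g, g ≠ h → g ≠ X.pair h → r g ∈ S → r (X.pair g) ∈ S) → v ∈ S := by
  rw [side, Set.mem_ofPred_eq, X.reachable_iff (X.edge_closed h)]
  simp only [Set.mem_insert_iff, Set.mem_singleton_iff, not_or, and_imp]

theorem root_mem_side (X : Wiring r ε) (h : H) : r h ∈ X.side h :=
  SimpleGraph.Reachable.refl _

theorem pair_mem_side (X : Wiring r ε) {h g : H} (h1 : g ≠ h) (h2 : g ≠ X.pair h)
    (hg : r g ∈ X.side h) : r (X.pair g) ∈ X.side h := by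
  rw [mem_side] at hg ⊢
  exact fun S hS hc => hc g h1 h2 (hg S hS hc)

theorem pair_mem_side_iff (X : Wiring r ε) {h g : H} (h1 : g ≠ h) (h2 : g ≠ X.pair h) :
    r (X.pair g) ∈ X.side h ↔ r g ∈ X.side h := by
  refine ⟨fun H => ?_, X.pair_mem_side h1 h2⟩
  have := X.pair_mem_side (h := h) (g := X.pair g) (fun h' => h2 ?_) (fun h' => h1 ?_) H
  · rwa [X.pair_pair] at this
  · rw [← h', X.pair_pair]
  · exact X.pair_injective h'

/-- `X.side h` is contained in every set which contains one of its points and which no other edge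
leaves. -/
theorem side_subset (X : Wiring r ε) {h : H} {S : Set V} (hS : (S ∩ X.side h).Nonempty)
    (hc : ∀ g, g ≠ h → g ≠ X.pair h → r g ∈ S → r (X.pair g) ∈ S) : X.side h ⊆ S := by
  have hroot : r h ∈ S := by
    by_contra hn
    obtain ⟨v, hv, hv'⟩ := hS
    refine (X.mem_side.1 hv' Sᶜ hn ?_) hv
    intro g h1 h2 hg hp
    have := hc (X.pair g) (fun h' => h2 ?_) (fun h' => h1 ?_) hp
    · rw [X.pair_pair] at this; exact hg this
    · rw [← h', X.pair_pair]
    · exact X.pair_injective h'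
  exact fun v hv => X.mem_side.1 hv S hroot hc

variable {k l : ℕ} {e : Fin k ⊕ Fin l ≃ Fin n}

theorem separates_iff (X : Wiring r ε) {h : H} :
    X.Separates e h ↔ X.pair h ≠ h ∧ X.sign (r h) = 1 ∧ X.sign (r (X.pair h)) = 1 ∧
      r (X.pair h) ∉ X.side h ∧ (∀ i, r (X.leg (e (Sum.inl i))) ∈ X.side h) ∧
      ∀ j, r (X.leg (e (Sum.inr j))) ∈ X.side (X.pair h) := by
  simp only [Separates, side, Set.mem_ofPred_eq, X.pair_pair, Set.pair_comm (X.pair h) h]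

/-- The complement of `X.side h` contains the far end of the edge, and no edge other than that of
`h` leaves it. -/
theorem disjoint_side (X : Wiring r ε) {h : H} (hn : r (X.pair h) ∉ X.side h) {v : V}
    (hv : v ∈ X.side (X.pair h)) : v ∉ X.side h := by
  have := X.side_subset (h := X.pair h) (S := (X.side h)ᶜ)
    ⟨_, hn, X.root_mem_side _⟩ ?_
  · exact this hv
  · intro g h1 h2 hg
    rw [X.pair_pair] at h2
    exact fun h' => hg ((X.pair_mem_side_iff h2 h1).1 h')

theorem Separates.right_notMem_side {X : Wiring r ε} {h : H} (hs : X.Separates e h) (j : Fin l) :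
    r (X.leg (e (Sum.inr j))) ∉ X.side h := by
  rw [separates_iff] at hs
  exact X.disjoint_side hs.2.2.2.1 (hs.2.2.2.2.2 j)

/-- If `h` lies outside the side of another separating edge then the part between the two edges
is a self-energy insertion. -/
theorem not_noSelfEnergy_of_separates (hk : 0 < k) {X : Wiring r ε}
    {h h' : H} (hs : X.Separates e h) (hs' : X.Separates e h') (hne : h ≠ h')
    (h1 : r h' ∉ X.side h) (h2 : r (X.pair h') ∉ X.side h) : ¬ X.NoSelfEnergy := by
  have hR := hs.right_notMem_side
  have hR' := hs'.right_notMem_side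
  rw [separates_iff] at hs hs'
  obtain ⟨-, -, -, hn, hL, -⟩ := hs
  obtain ⟨-, -, -, hn', hL', -⟩ := hs'
  have hrh : r h ∈ X.side h := X.root_mem_side h
  have hrh' : r h' ∈ X.side h' := X.root_mem_side h'
  have hne2 : h ≠ X.pair h' := fun H => h2 (H ▸ hrh)
  -- The edge of `h'` has no end in `X.side h`, so no edge but that of `h` leaves the intersection
  -- of the two sides. It is nonempty because leg `0`, which exists by `hk`, lies in both.
  have hsub : X.side h ⊆ X.side h' := by
    have := X.side_subset (h := h) (S := X.side h ∩ X.side h')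
      ⟨_, ⟨hL ⟨0, hk⟩, hL' ⟨0, hk⟩⟩, hL ⟨0, hk⟩⟩ ?_
    · exact fun v hv => (this hv).2
    · intro g g1 g2 hg
      refine ⟨X.pair_mem_side g1 g2 hg.1, X.pair_mem_side ?_ ?_ hg.2⟩
      · rintro rfl; exact h1 hg.1
      · rintro rfl; exact h2 hg.1
  have hph : r (X.pair h) ∈ X.side h' := X.pair_mem_side hne hne2 (hsub hrh)
  -- The separating edge is the only one that crosses the border of its side.
  have cross : ∀ g h, r (X.pair h) ∉ X.side h → r g ∈ X.side h → r (X.pair g) ∉ X.side h →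
      g = h := by
    intro g h hn hg hg'
    by_contra hgh
    by_cases hgp : g = X.pair h
    · subst hgp; exact hn hg
    · exact hg' (X.pair_mem_side hgh hgp hg)
  rw [noSelfEnergy_iff]
  intro H
  refine H (X.side h' \ X.side h) ⟨⟨r h', hrh', h1⟩, ?_⟩ ?_
  · rintro S ⟨u, huS, hu', hu⟩ hS
    -- the part of `S` between the edges contains the end `X.pair h`
    have step : ∀ S : Set V, r (X.pair h) ∈ S → (∀ g, r g ∈ S → r g ∈ X.side h' \ X.side h →
        r (X.pair g) ∈ X.side h' \ X.side h → r (X.pair g) ∈ S) → X.side h' \ X.side h ⊆ S := by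
      intro S hp hS v hv
      have := X.side_subset (h := h') (S := X.side h ∪ (S ∩ (X.side h' \ X.side h)))
        ⟨_, Or.inl hrh, hsub hrh⟩ ?_
      · exact ((this hv.1).resolve_left hv.2).1
      · rintro g g1 g2 hg
        by_cases hpg : r (X.pair g) ∈ X.side h
        · exact Or.inl hpg
        refine Or.inr ?_
        rcases hg with hg | ⟨hgS, hg'⟩
        · obtain rfl := cross g h hn hg hpg
          exact ⟨hp, hph, hpg⟩
        · have : r (X.pair g) ∈ X.side h' \ X.side h := ⟨X.pair_mem_side g1 g2 hg'.1, hpg⟩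
          exact ⟨hS g hgS hg' this, this⟩
    have hpS : r (X.pair h) ∈ S := by
      by_contra hpS
      refine step Sᶜ hpS ?_ ⟨hu', hu⟩ huS
      intro g hg hgU hpU hpS
      have := hS _ hpS hpU
      rw [X.pair_pair] at this
      exact hg (this hgU)
    exact step S hpS hS
  · have : X.boundary (X.side h' \ X.side h) = {X.pair h, h'} := by
      ext g
      simp only [boundary, Set.mem_ofPred_eq, Set.mem_insert_iff, Set.mem_singleton_iff]
      constructor
      · rintro ⟨⟨hg', hg⟩, hleg | hp⟩
        · obtain ⟨i, rfl⟩ := (X.pair_eq_iff g).1 hleg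
          obtain ⟨i, rfl⟩ := e.surjective i
          rcases i with i | j
          · exact absurd (hL i) hg
          · exact absurd hg' (hR' j)
        · by_cases hpg : r (X.pair g) ∈ X.side h
          · left
            have := cross (X.pair g) h hn hpg (by rwa [X.pair_pair])
            rw [← this, X.pair_pair]
          · right
            exact cross g h' hn' hg' fun hp' => hp ⟨hp', hpg⟩
      · rintro (rfl | rfl)
        · exact ⟨⟨hph, hn⟩, Or.inr fun h => h.2 (by rwa [X.pair_pair])⟩
        · exact ⟨⟨hrh', h1⟩, Or.inr fun h => hn' h.1⟩
    rw [this, Set.ncard_pair]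
    rintro rfl
    rw [X.pair_pair] at h2
    exact h2 hrh

/-- Without self-energy insertions there is at most one separating edge. -/
theorem NoSelfEnergy.separates_unique (hk : 0 < k) (hl : 0 < l) {X : Wiring r ε}
    (hse : X.NoSelfEnergy) {h h' : H} (hs : X.Separates e h)
    (hs' : X.Separates e h') : h = h' := by
  by_contra hne
  have hL := (X.separates_iff.1 hs).2.2.2.2.1 ⟨0, hk⟩
  have hL' := (X.separates_iff.1 hs').2.2.2.2.1 ⟨0, hk⟩
  have hR := hs.right_notMem_side ⟨0, hl⟩
  have hR' := hs'.right_notMem_side ⟨0, hl⟩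
  -- The same edge with the opposite orientation would put leg `0` on both sides.
  have hne2 : h' ≠ X.pair h := by
    rintro rfl
    exact X.disjoint_side (X.separates_iff.1 hs).2.2.2.1 hL' hL
  -- The edge of `h'` lies entirely on one side of `h`. If on the near side, then the edge of `h`
  -- lies outside the side of `h'`, and the preceding result applies with the two exchanged.
  by_cases h1 : r h' ∈ X.side h
  · have h2 := X.pair_mem_side (Ne.symm hne) hne2 h1
    have hcompl : X.side (X.pair h) ⊆ (X.side h')ᶜ := by
      have := X.side_subset (h := X.pair h) (S := X.side (X.pair h) ∩ (X.side h')ᶜ)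
        ⟨_, ⟨(X.separates_iff.1 hs).2.2.2.2.2 ⟨0, hl⟩, hR'⟩,
          (X.separates_iff.1 hs).2.2.2.2.2 ⟨0, hl⟩⟩ ?_
      · exact fun v hv => (this hv).2
      · intro g g1 g2 hg
        refine ⟨X.pair_mem_side g1 g2 hg.1, fun hp => hg.2 ((X.pair_mem_side_iff ?_ ?_).1 hp)⟩
        · rintro rfl
          exact X.disjoint_side (X.separates_iff.1 hs).2.2.2.1 hg.1 h1
        · rintro rfl
          exact X.disjoint_side (X.separates_iff.1 hs).2.2.2.1 hg.1 h2
    have hp : r (X.pair h) ∉ X.side h' := hcompl (X.root_mem_side _)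
    refine not_noSelfEnergy_of_separates hk hs' hs (Ne.symm hne) ?_ hp hse
    intro hr
    refine hp (X.pair_mem_side hne ?_ hr)
    rintro rfl
    exact hne2 (X.pair_pair _).symm
  · refine not_noSelfEnergy_of_separates hk hs hs' hne h1 ?_ hse
    exact fun h2 => h1 ((X.pair_mem_side_iff (Ne.symm hne) hne2).1 h2)

end Wiring

end GGreen

/-! ### Joining two diagrams: connectedness and self-energy insertions -/

namespace GGreen

/-- A decomposition of a system of half-edges, and of `n` legs, into two. -/
structure Splitting {V H V₁ H₁ V₂ H₂ : Type*} (r : H → V) (r₁ : H₁ → V₁) (r₂ : H₂ → V₂)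
    (n k l : ℕ) where
  vert : V₁ ⊕ V₂ ≃ V
  half : H₁ ⊕ H₂ ≃ H
  leg : Fin k ⊕ Fin l ≃ Fin n
  root_half : ∀ h, r (half h) = vert (Sum.map r₁ r₂ h)

namespace Splitting

variable {V H V₁ H₁ V₂ H₂ : Type*} {r : H → V} {r₁ : H₁ → V₁} {r₂ : H₂ → V₂} {n k l : ℕ}

/-- The same decomposition with the parts exchanged. -/
def swap (S : Splitting r r₁ r₂ n k l) : Splitting r r₂ r₁ n l k where
  vert := (Equiv.sumComm _ _).trans S.vert
  half := (Equiv.sumComm _ _).trans S.half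
  leg := (Equiv.sumComm _ _).trans S.leg
  root_half := by rintro (h | h) <;> simp [S.root_half]

@[simp] theorem swap_vert_inl (S : Splitting r r₁ r₂ n k l) (v : V₂) :
    S.swap.vert (Sum.inl v) = S.vert (Sum.inr v) := rfl

@[simp] theorem swap_half_inl (S : Splitting r r₁ r₂ n k l) (h : H₂) :
    S.swap.half (Sum.inl h) = S.half (Sum.inr h) := rfl

@[simp] theorem swap_leg_inr (S : Splitting r r₁ r₂ n k l) (i : Fin k) :
    S.swap.leg (Sum.inr i) = S.leg (Sum.inl i) := rfl

@[simp] theorem root_inl (S : Splitting r r₁ r₂ n k l) (h : H₁) :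
    r (S.half (Sum.inl h)) = S.vert (Sum.inl (r₁ h)) := S.root_half _

@[simp] theorem root_inr (S : Splitting r r₁ r₂ n k l) (h : H₂) :
    r (S.half (Sum.inr h)) = S.vert (Sum.inr (r₂ h)) := S.root_half _

/-- The vertices of the first part. -/
def left (S : Splitting r r₁ r₂ n k l) : Set V := Set.range fun v => S.vert (Sum.inl v)

@[simp] theorem inl_mem_left (S : Splitting r r₁ r₂ n k l) (v : V₁) :
    S.vert (Sum.inl v) ∈ S.left := ⟨v, rfl⟩

@[simp] theorem inr_notMem_left (S : Splitting r r₁ r₂ n k l) (v : V₂) :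
    S.vert (Sum.inr v) ∉ S.left := by simp [left]

theorem left_swap (S : Splitting r r₁ r₂ n k l) : S.swap.left = S.leftᶜ := by
  ext v
  obtain ⟨v | v, rfl⟩ := S.vert.surjective v
  · simp [left]
  · simp [left]

theorem half_cases (S : Splitting r r₁ r₂ n k l) (h : H) :
    (∃ a, h = S.half (Sum.inl a)) ∨ ∃ b, h = S.half (Sum.inr b) := by
  obtain ⟨a | a, rfl⟩ := S.half.surjective h
  · exact Or.inl ⟨a, rfl⟩
  · exact Or.inr ⟨a, rfl⟩

theorem vert_cases (S : Splitting r r₁ r₂ n k l) (v : V) :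
    (∃ a, v = S.vert (Sum.inl a)) ∨ ∃ b, v = S.vert (Sum.inr b) := by
  obtain ⟨a | a, rfl⟩ := S.vert.surjective v
  · exact Or.inl ⟨a, rfl⟩
  · exact Or.inr ⟨a, rfl⟩

end Splitting

variable {V H V₁ H₁ V₂ H₂ : Type*} {r : H → V} {r₁ : H₁ → V₁} {r₂ : H₂ → V₂} {n k l : ℕ}
  {ε : Fin n → ℤˣ} {ε₁ : Fin (k + 1) → ℤˣ} {ε₂ : Fin (l + 1) → ℤˣ}

/-- `X` arises from `X₁` and `X₂` by joining their last legs to an edge. -/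
structure IsGlue (S : Splitting r r₁ r₂ n k l) (X : Wiring r ε) (X₁ : Wiring r₁ ε₁)
    (X₂ : Wiring r₂ ε₂) : Prop where
  sign_left : ∀ v, X.sign (S.vert (Sum.inl v)) = X₁.sign v
  sign_right : ∀ v, X.sign (S.vert (Sum.inr v)) = X₂.sign v
  leg_left : ∀ i : Fin k, X.leg (S.leg (Sum.inl i)) = S.half (Sum.inl (X₁.leg i.castSucc))
  leg_right : ∀ i : Fin l, X.leg (S.leg (Sum.inr i)) = S.half (Sum.inr (X₂.leg i.castSucc))
  pair_left : ∀ h, h ≠ X₁.leg (Fin.last k) →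
    X.pair (S.half (Sum.inl h)) = S.half (Sum.inl (X₁.pair h))
  pair_right : ∀ h, h ≠ X₂.leg (Fin.last l) →
    X.pair (S.half (Sum.inr h)) = S.half (Sum.inr (X₂.pair h))
  pair_last : X.pair (S.half (Sum.inl (X₁.leg (Fin.last k)))) =
    S.half (Sum.inr (X₂.leg (Fin.last l)))

namespace IsGlue

variable {S : Splitting r r₁ r₂ n k l} {X : Wiring r ε} {X₁ : Wiring r₁ ε₁} {X₂ : Wiring r₂ ε₂}

/-- By this symmetry, facts about the first part yield those about the second. -/
theorem swap (g : IsGlue S X X₁ X₂) : IsGlue S.swap X X₂ X₁ where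
  sign_left := g.sign_right
  sign_right := g.sign_left
  leg_left := g.leg_right
  leg_right := g.leg_left
  pair_left := g.pair_right
  pair_right := g.pair_left
  pair_last := by
    have := congrArg X.pair g.pair_last
    rw [X.pair_pair] at this
    exact this.symm

theorem pair_last' (g : IsGlue S X X₁ X₂) : X.pair (S.half (Sum.inr (X₂.leg (Fin.last l)))) =
    S.half (Sum.inl (X₁.leg (Fin.last k))) := g.swap.pair_last

theorem pair_inl_cases (g : IsGlue S X X₁ X₂) (h : H₁) :
    (h = X₁.leg (Fin.last k) ∧ X₁.pair h = h ∧
      X.pair (S.half (Sum.inl h)) = S.half (Sum.inr (X₂.leg (Fin.last l)))) ∨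
    h ≠ X₁.leg (Fin.last k) ∧ X.pair (S.half (Sum.inl h)) = S.half (Sum.inl (X₁.pair h)) := by
  by_cases hh : h = X₁.leg (Fin.last k)
  · subst hh; exact Or.inl ⟨rfl, X₁.pair_leg _, g.pair_last⟩
  · exact Or.inr ⟨hh, g.pair_left h hh⟩

theorem pair_inr_cases (g : IsGlue S X X₁ X₂) (h : H₂) :
    (h = X₂.leg (Fin.last l) ∧ X₂.pair h = h ∧
      X.pair (S.half (Sum.inr h)) = S.half (Sum.inl (X₁.leg (Fin.last k)))) ∨
    h ≠ X₂.leg (Fin.last l) ∧ X.pair (S.half (Sum.inr h)) = S.half (Sum.inr (X₂.pair h)) :=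
  g.swap.pair_inl_cases h

theorem connectedOn_image (g : IsGlue S X X₁ X₂) (U : Set V₁) :
    X.ConnectedOn ((fun v => S.vert (Sum.inl v)) '' U) ↔ X₁.ConnectedOn U := by
  have hmem : ∀ {T : Set V₁} {v}, S.vert (Sum.inl v) ∈ (fun v => S.vert (Sum.inl v)) '' T ↔
      v ∈ T := by simp
  have hnot : ∀ {T : Set V₁} {v}, S.vert (Sum.inr v) ∉ (fun v => S.vert (Sum.inl v)) '' T := by
    simp
  constructor
  · rintro ⟨hne, hc⟩
    refine ⟨Set.image_nonempty.1 hne, fun T hT hcl => ?_⟩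
    have := hc ((fun v => S.vert (Sum.inl v)) '' T) ?_ ?_
    · exact fun v hv => hmem.1 (this (hmem.2 hv))
    · obtain ⟨v, h1, h2⟩ := hT
      exact ⟨_, hmem.2 h1, hmem.2 h2⟩
    · intro h hT hU hp
      rcases S.half_cases h with ⟨a, rfl⟩ | ⟨b, rfl⟩
      · rcases g.pair_inl_cases a with ⟨-, -, h2⟩ | ⟨-, h2⟩
        · rw [h2, S.root_inr] at hp
          exact absurd hp hnot
        · rw [h2, S.root_inl] at hp ⊢
          rw [S.root_inl] at hT hU
          exact hmem.2 (hcl a (hmem.1 hT) (hmem.1 hU) (hmem.1 hp))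
      · rw [S.root_inr] at hT
        exact absurd hT hnot
  · rintro ⟨hne, hc⟩
    refine ⟨hne.image _, fun T hT hcl => ?_⟩
    have := hc ((fun v => S.vert (Sum.inl v)) ⁻¹' T) ?_ ?_
    · rintro _ ⟨v, hv, rfl⟩
      exact this hv
    · obtain ⟨_, h1, v, h2, rfl⟩ := hT
      exact ⟨v, h1, h2⟩
    · intro a hT hU hp
      rcases g.pair_inl_cases a with ⟨-, h2, -⟩ | ⟨-, h2⟩
      · rwa [h2]
      · have := hcl (S.half (Sum.inl a)) (by rwa [S.root_inl])
          (by rw [S.root_inl]; exact hmem.2 hU) (by rw [h2, S.root_inl]; exact hmem.2 hp)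
        rwa [h2, S.root_inl] at this

/-- The intersection of a connected set with one of the parts is connected or empty. -/
theorem connectedOn_inter_left (g : IsGlue S X X₁ X₂) {U : Set V} (hU : X.ConnectedOn U)
    (hne : (U ∩ S.left).Nonempty) : X.ConnectedOn (U ∩ S.left) := by
  refine ⟨hne, ?_⟩
  rintro T ⟨u, huT, huU, huL⟩ hT
  -- `T` is completed to a set closed inside `U` by adding all of the second part if `T` contains
  -- the end of the joining edge, and nothing otherwise.
  have key : ∀ R : Set V₂, (R = Set.univ ∧ S.vert (Sum.inl (r₁ (X₁.leg (Fin.last k)))) ∈ T) ∨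
      (R = ∅ ∧ S.vert (Sum.inl (r₁ (X₁.leg (Fin.last k)))) ∉ T) →
      U ⊆ (T ∩ S.left) ∪ (fun v => S.vert (Sum.inr v)) '' R := by
    intro R hR
    refine hU.2 _ ⟨u, Or.inl ⟨huT, huL⟩, huU⟩ ?_
    intro h hh hhU hpU
    rcases S.half_cases h with ⟨a, rfl⟩ | ⟨b, rfl⟩
    · have hT' : r (S.half (Sum.inl a)) ∈ T := by
        rcases hh with hh | ⟨v, -, hv⟩
        · exact hh.1
        · rw [S.root_inl] at hv; simp at hv
      rcases g.pair_inl_cases a with ⟨h1, -, h2⟩ | ⟨-, h2⟩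
      · rcases hR with ⟨rfl, -⟩ | ⟨-, h3⟩
        · right; rw [h2, S.root_inr]; simp
        · rw [S.root_inl, h1] at hT'
          exact absurd hT' h3
      · left
        have hl : r (X.pair (S.half (Sum.inl a))) ∈ S.left := by rw [h2]; simp
        exact ⟨hT _ hT' ⟨hhU, by simp⟩ ⟨hpU, hl⟩, hl⟩
    · rcases hh with hh | ⟨v, hv, -⟩
      · rw [S.root_inr] at hh
        exact absurd hh.2 (S.inr_notMem_left _)
      · rcases hR with ⟨rfl, h3⟩ | ⟨rfl, -⟩
        · rcases g.pair_inr_cases b with ⟨h1, -, h2⟩ | ⟨-, h2⟩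
          · left; rw [h2, S.root_inl]; exact ⟨h3, by simp⟩
          · right; rw [h2, S.root_inr]; simp
        · exact absurd hv (by simp)
  rintro v ⟨hvU, hvL⟩
  have : ∃ R : Set V₂, (R = Set.univ ∧ S.vert (Sum.inl (r₁ (X₁.leg (Fin.last k)))) ∈ T) ∨
      (R = ∅ ∧ S.vert (Sum.inl (r₁ (X₁.leg (Fin.last k)))) ∉ T) := by
    by_cases h : S.vert (Sum.inl (r₁ (X₁.leg (Fin.last k)))) ∈ T
    · exact ⟨_, Or.inl ⟨rfl, h⟩⟩
    · exact ⟨_, Or.inr ⟨rfl, h⟩⟩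
  obtain ⟨R, hR⟩ := this
  rcases key R hR hvU with h | ⟨w, -, rfl⟩
  · exact h.1
  · exact absurd hvL (S.inr_notMem_left _)

theorem image_preimage_left (S : Splitting r r₁ r₂ n k l) (U : Set V) :
    (fun v => S.vert (Sum.inl v)) '' ((fun v => S.vert (Sum.inl v)) ⁻¹' U) = U ∩ S.left :=
  Set.image_preimage_eq_inter_range

theorem connectedOn_preimage (g : IsGlue S X X₁ X₂) {U : Set V} (hU : X.ConnectedOn U)
    (hne : (U ∩ S.left).Nonempty) :
    X₁.ConnectedOn ((fun v => S.vert (Sum.inl v)) ⁻¹' U) := by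
  rw [← g.connectedOn_image, image_preimage_left]
  exact g.connectedOn_inter_left hU hne

theorem connected_left (g : IsGlue S X X₁ X₂) (hX : X.Connected) : X₁.Connected := by
  rw [Wiring.connected_iff] at hX ⊢
  exact g.connectedOn_preimage hX ⟨S.vert (Sum.inl (r₁ (X₁.leg (Fin.last k)))), by simp⟩

/-- A set which no edge leaves and which meets a connected part contains it. -/
theorem left_subset (g : IsGlue S X X₁ X₂) (h₁ : X₁.Connected) {T : Set V} {v : V₁}
    (hv : S.vert (Sum.inl v) ∈ T)
    (hT : ∀ h, h ≠ S.half (Sum.inl (X₁.leg (Fin.last k))) →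
      h ≠ S.half (Sum.inr (X₂.leg (Fin.last l))) → r h ∈ T → r (X.pair h) ∈ T) :
    S.left ⊆ T := by
  have : (fun v => S.vert (Sum.inl v)) ⁻¹' T = Set.univ := by
    refine h₁.eq_univ ⟨v, hv⟩ fun a ha => ?_
    rcases g.pair_inl_cases a with ⟨-, h2, -⟩ | ⟨h1, h2⟩
    · rwa [h2]
    · have := hT (S.half (Sum.inl a)) (by simpa using h1) (by simp) (by rwa [S.root_inl])
      rwa [h2, S.root_inl] at this
  rintro _ ⟨w, rfl⟩
  exact this.ge (Set.mem_univ w)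

theorem connected_iff (g : IsGlue S X X₁ X₂) :
    X.Connected ↔ X₁.Connected ∧ X₂.Connected := by
  refine ⟨fun h => ⟨g.connected_left h, g.swap.connected_left h⟩, ?_⟩
  rintro ⟨h₁, h₂⟩
  rw [Wiring.connected_iff]
  refine ⟨⟨S.vert (Sum.inl (r₁ (X₁.leg (Fin.last k)))), trivial⟩, ?_⟩
  rintro T ⟨v, hv, -⟩ hT
  replace hT : ∀ h, r h ∈ T → r (X.pair h) ∈ T := fun h hh => hT h hh trivial trivial
  have hc := hT (S.half (Sum.inl (X₁.leg (Fin.last k))))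
  have hc' := hT (S.half (Sum.inr (X₂.leg (Fin.last l))))
  rw [g.pair_last, S.root_inl, S.root_inr] at hc
  rw [g.pair_last', S.root_inl, S.root_inr] at hc'
  have hl : ∀ {v}, S.vert (Sum.inl v) ∈ T → S.left ⊆ T :=
    fun hv => g.left_subset h₁ hv fun h _ _ => hT h
  have hr : ∀ {v}, S.vert (Sum.inr v) ∈ T → S.leftᶜ ⊆ T := fun hv => by
    rw [← S.left_swap]
    exact g.swap.left_subset h₂ hv fun h _ _ => hT h
  have both : S.left ⊆ T ∧ S.leftᶜ ⊆ T := by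
    rcases S.vert_cases v with ⟨v, rfl⟩ | ⟨v, rfl⟩
    · exact ⟨hl hv, hr (hc (hl hv (by simp)))⟩
    · exact ⟨hl (hc' (hr hv (by simp))), hr hv⟩
  intro w _
  by_cases hw : w ∈ S.left
  · exact both.1 hw
  · exact both.2 hw

theorem inl_mem_boundary (g : IsGlue S X X₁ X₂) {U : Set V} {a : H₁} :
    a ∈ X₁.boundary ((fun v => S.vert (Sum.inl v)) ⁻¹' U) ↔
      S.half (Sum.inl a) ∈ X.boundary U ∨
        a = X₁.leg (Fin.last k) ∧ S.vert (Sum.inl (r₁ a)) ∈ U := by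
  simp only [Wiring.boundary, Set.mem_ofPred_eq, Set.mem_preimage, S.root_inl]
  rcases g.pair_inl_cases a with ⟨h1, h2, h3⟩ | ⟨h1, h2⟩
  · simp only [h1, X₁.pair_leg, true_and, true_or, and_true]
    tauto
  · simp [h1, h2]

theorem boundary_image (g : IsGlue S X X₁ X₂) (U : Set V₁) :
    X.boundary ((fun v => S.vert (Sum.inl v)) '' U) =
      (fun h => S.half (Sum.inl h)) '' X₁.boundary U := by
  ext h
  rcases S.half_cases h with ⟨a, rfl⟩ | ⟨b, rfl⟩
  · simp only [Wiring.boundary, Set.mem_ofPred_eq, S.root_inl]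
    rcases g.pair_inl_cases a with ⟨h1, h2, h3⟩ | ⟨h1, h2⟩
    · simp [h3, h2]
    · simp [h2]
  · simp [Wiring.boundary]

theorem half_inl_injective (S : Splitting r r₁ r₂ n k l) :
    Function.Injective fun h => S.half (Sum.inl h) :=
  S.half.injective.comp Sum.inl_injective

theorem noSelfEnergy_left (g : IsGlue S X X₁ X₂) (hX : X.NoSelfEnergy) : X₁.NoSelfEnergy := by
  rw [Wiring.noSelfEnergy_iff] at hX ⊢
  intro U hU hb
  refine hX _ ((g.connectedOn_image U).2 hU) ?_
  rw [g.boundary_image, Set.ncard_image_of_injective _ (half_inl_injective S), hb]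

end IsGlue

/-- In a connected diagram with at least two legs, more than one half-edge leaves a set of
vertices to which a leg is attached. -/
theorem Wiring.Connected.boundary_ncard_ne_one {X : Wiring r ε} (hX : X.Connected) {i j : Fin n}
    (hij : i ≠ j) {U : Set V} (hi : r (X.leg i) ∈ U) : (X.boundary U).ncard ≠ 1 := by
  intro hb
  obtain ⟨a, ha⟩ := Set.ncard_eq_one.1 hb
  have hia : X.leg i ∈ X.boundary U := ⟨hi, Or.inl (X.pair_leg i)⟩
  -- If leg `i` alone leaves `U`, then no edge does, so `U` is everything; but then leg `j` leaves
  -- it too.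
  have hU : U = Set.univ := by
    refine hX.eq_univ ⟨_, hi⟩ fun h hh => ?_
    by_contra hp
    have h1 : h ∈ X.boundary U := ⟨hh, Or.inr hp⟩
    rw [ha, Set.mem_singleton_iff] at hia h1
    rw [h1, ← hia, X.pair_leg] at hp
    exact hp hi
  have hja : X.leg j ∈ X.boundary U := ⟨hU ▸ trivial, Or.inl (X.pair_leg j)⟩
  rw [ha, Set.mem_singleton_iff] at hia hja
  exact hij (X.leg_injective (hia.trans hja.symm))

namespace IsGlue

variable {S : Splitting r r₁ r₂ n k l} {X : Wiring r ε} {X₁ : Wiring r₁ ε₁} {X₂ : Wiring r₂ ε₂}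

/-- A connected set which meets both parts contains the ends of the joining edge. -/
theorem last_mem (g : IsGlue S X X₁ X₂) {U : Set V} (hU : X.ConnectedOn U)
    (h1 : (U ∩ S.left).Nonempty) (h2 : (U ∩ S.leftᶜ).Nonempty) :
    S.vert (Sum.inl (r₁ (X₁.leg (Fin.last k)))) ∈ U ∧
      S.vert (Sum.inr (r₂ (X₂.leg (Fin.last l)))) ∈ U := by
  by_contra hn
  obtain ⟨v, hvU, hv⟩ := h2
  refine hv (hU.2 S.left (by rwa [Set.inter_comm]) ?_ hvU)
  intro h hl hhU hpU
  rcases S.half_cases h with ⟨a, rfl⟩ | ⟨b, rfl⟩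
  · rcases g.pair_inl_cases a with ⟨h1, -, h3⟩ | ⟨-, h3⟩
    · rw [h3, S.root_inr] at hpU
      rw [S.root_inl, h1] at hhU
      exact absurd ⟨hhU, hpU⟩ hn
    · rw [h3]; simp
  · rw [S.root_inr] at hl
    exact absurd hl (S.inr_notMem_left _)

/-- The joining edge is internal to `U`, but in the part its half is an external leg; this is the
extra `1`. -/
theorem ncard_boundary_left [Finite H] (g : IsGlue S X X₁ X₂) {U : Set V}
    (h1 : S.vert (Sum.inl (r₁ (X₁.leg (Fin.last k)))) ∈ U)
    (h2 : S.vert (Sum.inr (r₂ (X₂.leg (Fin.last l)))) ∈ U) :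
    (X₁.boundary ((fun v => S.vert (Sum.inl v)) ⁻¹' U)).ncard =
      (X.boundary U ∩ Set.range fun h => S.half (Sum.inl h)).ncard + 1 := by
  have hni : S.half (Sum.inl (X₁.leg (Fin.last k))) ∉
      X.boundary U ∩ Set.range fun h => S.half (Sum.inl h) := by
    rintro ⟨⟨-, h | h⟩, -⟩
    · rw [g.pair_last] at h; simp at h
    · rw [g.pair_last, S.root_inr] at h; exact h h2
  rw [← Set.ncard_image_of_injective _ (half_inl_injective S), ← Set.ncard_insert_of_notMem hni]
  congr 1
  ext h
  rcases S.half_cases h with ⟨a, rfl⟩ | ⟨b, rfl⟩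
  · have : S.half (Sum.inl a) ∈ (fun h => S.half (Sum.inl h)) ''
        X₁.boundary ((fun v => S.vert (Sum.inl v)) ⁻¹' U) ↔
        a ∈ X₁.boundary ((fun v => S.vert (Sum.inl v)) ⁻¹' U) := by simp
    rw [this, g.inl_mem_boundary]
    simp only [Set.mem_insert_iff, Set.mem_inter_iff, EmbeddingLike.apply_eq_iff_eq,
      Sum.inl.injEq, Set.mem_range_self, and_true]
    constructor
    · rintro (h | ⟨h, -⟩)
      · exact Or.inr h
      · exact Or.inl h
    · rintro (rfl | h)
      · exact Or.inr ⟨rfl, h1⟩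
      · exact Or.inl h
  · simp

/-- Only a connected `U` that meets both parts is a new case. If `a` and `b` half-edges leave it
from the two parts, the traces of `U` are left by `a + 1` and `b + 1`. These numbers are not `2` by
assumption, and not `1` because each part has a second leg (`hk`, `hl`). So `a, b ≥ 2` and `a + b ≠
2`. -/
theorem noSelfEnergy_iff [Finite H] (hk : 0 < k) (hl : 0 < l) (g : IsGlue S X X₁ X₂)
    (hX : X.Connected) : X.NoSelfEnergy ↔ X₁.NoSelfEnergy ∧ X₂.NoSelfEnergy := by
  refine ⟨fun h => ⟨g.noSelfEnergy_left h, g.swap.noSelfEnergy_left h⟩, ?_⟩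
  rintro ⟨hs₁, hs₂⟩
  obtain ⟨hc₁, hc₂⟩ := g.connected_iff.1 hX
  rw [Wiring.noSelfEnergy_iff] at hs₁ hs₂ ⊢
  intro U hU hb
  rcases Set.eq_empty_or_nonempty (U ∩ S.left) with h1 | h1
  · have hUl : U ∩ S.swap.left = U := by
      rw [S.left_swap, Set.inter_eq_left]
      exact fun v hv hl => h1.le ⟨hv, hl⟩
    have := g.swap.connectedOn_preimage hU (by rw [hUl]; exact hU.1)
    refine hs₂ _ this ?_
    rw [← Set.ncard_image_of_injective _ (half_inl_injective S.swap), ← g.swap.boundary_image,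
      image_preimage_left, hUl, hb]
  rcases Set.eq_empty_or_nonempty (U ∩ S.leftᶜ) with h2 | h2
  · have hUl : U ∩ S.left = U := by
      rw [Set.inter_eq_left]
      exact fun v hv => by_contra fun hl => h2.le ⟨hv, hl⟩
    have := g.connectedOn_preimage hU h1
    refine hs₁ _ this ?_
    rw [← Set.ncard_image_of_injective _ (half_inl_injective S), ← g.boundary_image,
      image_preimage_left, hUl, hb]
  obtain ⟨m1, m2⟩ := g.last_mem hU h1 h2
  have c1 := g.ncard_boundary_left m1 m2
  have c2 := g.swap.ncard_boundary_left m2 m1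
  have n1 := hs₁ _ (g.connectedOn_preimage hU h1)
  have n2 := hs₂ _ (g.swap.connectedOn_preimage hU (by rwa [S.left_swap]))
  have o1 := hc₁.boundary_ncard_ne_one (i := Fin.last k) (j := 0) (by simp [Fin.ext_iff, hk.ne'])
    (U := (fun v => S.vert (Sum.inl v)) ⁻¹' U) m1
  have o2 := hc₂.boundary_ncard_ne_one (i := Fin.last l) (j := 0) (by simp [Fin.ext_iff, hl.ne'])
    (U := (fun v => S.swap.vert (Sum.inl v)) ⁻¹' U) m2
  have hsum : (X.boundary U).ncard =
      (X.boundary U ∩ Set.range fun h => S.half (Sum.inl h)).ncard +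
      (X.boundary U ∩ Set.range fun h => S.swap.half (Sum.inl h)).ncard := by
    rw [← Set.ncard_union_eq]
    · congr 1
      rw [← Set.inter_union_distrib_left, eq_comm, Set.inter_eq_left]
      intro h _
      rcases S.half_cases h with ⟨a, rfl⟩ | ⟨b, rfl⟩
      · exact Or.inl ⟨a, rfl⟩
      · exact Or.inr ⟨b, rfl⟩
    · rw [Set.disjoint_left]
      rintro _ ⟨-, a, rfl⟩ ⟨-, b, hb⟩
      simp at hb
  omega

theorem side_left (g : IsGlue S X X₁ X₂) (h₁ : X₁.Connected) :
    X.side (S.half (Sum.inl (X₁.leg (Fin.last k)))) = S.left := by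
  apply Set.Subset.antisymm
  · refine X.side_subset ⟨_, by simp, X.root_mem_side _⟩ ?_
    intro h n1 n2 hh
    rw [g.pair_last] at n2
    rcases S.half_cases h with ⟨a, rfl⟩ | ⟨b, rfl⟩
    · rw [g.pair_left a (by simpa using n1)]; simp
    · rw [S.root_inr] at hh
      exact absurd hh (S.inr_notMem_left _)
  · refine g.left_subset h₁ (v := r₁ (X₁.leg (Fin.last k))) ?_ ?_
    · rw [← S.root_inl]; exact X.root_mem_side _
    · intro h n1 n2 hh
      exact X.pair_mem_side n1 (by rwa [g.pair_last]) hh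

theorem separates (g : IsGlue S X X₁ X₂) (h₁ : X₁.Connected) (h₂ : X₂.Connected)
    (hε₁ : ε₁ (Fin.last k) = 1) (hε₂ : ε₂ (Fin.last l) = 1) :
    X.Separates S.leg (S.half (Sum.inl (X₁.leg (Fin.last k)))) := by
  rw [Wiring.separates_iff, g.side_left h₁, g.pair_last]
  have := g.swap.side_left h₂
  rw [S.swap_half_inl, S.left_swap] at this
  rw [this]
  refine ⟨by simp, ?_, ?_, by simp, fun i => ?_, fun j => ?_⟩
  · rw [S.root_inl, g.sign_left, X₁.sign_leg, hε₁]
  · rw [S.root_inr, g.sign_right, X₂.sign_leg, hε₂]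
  · rw [g.leg_left]; simp
  · rw [g.leg_right]; simp

/-- `X` alone does not reveal which of its edges is the joining one, hence the hypothesis on the
last legs. The pair (`X`, joining half-edge) does determine the parts. -/
theorem eq_left {Y₁ : Wiring r₁ ε₁} {Y₂ : Wiring r₂ ε₂} (g : IsGlue S X X₁ X₂)
    (g' : IsGlue S X Y₁ Y₂) (h : X₁.leg (Fin.last k) = Y₁.leg (Fin.last k)) : X₁ = Y₁ := by
  have hinj := half_inl_injective S
  ext1
  · funext v; rw [← g.sign_left, ← g'.sign_left]
  · funext a
    by_cases ha : a = X₁.leg (Fin.last k)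
    · rw [ha, X₁.pair_leg, h, Y₁.pair_leg]
    · apply hinj
      change S.half _ = S.half _
      rw [← g.pair_left a ha, ← g'.pair_left a (h ▸ ha)]
  · funext i
    refine Fin.lastCases h (fun i => hinj ?_) i
    change S.half _ = S.half _
    rw [← g.leg_left, ← g'.leg_left]

end IsGlue

end GGreen

/-! ### Existence and uniqueness of joining and cutting -/

namespace GGreen

variable {V H V₁ H₁ V₂ H₂ : Type*} {r : H → V} {r₁ : H₁ → V₁} {r₂ : H₂ → V₂} {n k l : ℕ}
  {ε : Fin n → ℤˣ} {ε₁ : Fin (k + 1) → ℤˣ} {ε₂ : Fin (l + 1) → ℤˣ}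

open Classical in
/-- The involution on the half-edges of two diagrams which joins their last legs. -/
def gluePair (X₁ : Wiring r₁ ε₁) (X₂ : Wiring r₂ ε₂) : H₁ ⊕ H₂ → H₁ ⊕ H₂ :=
  Sum.elim
    (fun a => if a = X₁.leg (Fin.last k) then Sum.inr (X₂.leg (Fin.last l))
      else Sum.inl (X₁.pair a))
    (fun b => if b = X₂.leg (Fin.last l) then Sum.inl (X₁.leg (Fin.last k))
      else Sum.inr (X₂.pair b))

theorem Wiring.pair_eq_leg_iff (X : Wiring r ε) {h : H} {i : Fin n} :
    X.pair h = X.leg i ↔ h = X.leg i := by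
  rw [← X.pair_leg i, X.pair_injective.eq_iff, X.pair_leg]

theorem gluePair_gluePair (X₁ : Wiring r₁ ε₁) (X₂ : Wiring r₂ ε₂) (h : H₁ ⊕ H₂) :
    gluePair X₁ X₂ (gluePair X₁ X₂ h) = h := by
  rcases h with a | b
  · by_cases ha : a = X₁.leg (Fin.last k)
    · simp [gluePair, ha]
    · simp [gluePair, ha, X₁.pair_eq_leg_iff, X₁.pair_pair]
  · by_cases hb : b = X₂.leg (Fin.last l)
    · simp [gluePair, hb]
    · simp [gluePair, hb, X₂.pair_eq_leg_iff, X₂.pair_pair]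

theorem mem_range_iff_castSucc {α : Type*} {f : Fin (k + 1) → α} {a : α} (ha : a ≠ f (Fin.last k)) :
    a ∈ Set.range f ↔ ∃ i : Fin k, f i.castSucc = a := by
  constructor
  · rintro ⟨i, rfl⟩
    induction i using Fin.lastCases with
    | last => exact absurd rfl ha
    | cast i => exact ⟨i, rfl⟩
  · rintro ⟨i, rfl⟩
    exact ⟨_, rfl⟩

theorem exists_isGlue (S : Splitting r r₁ r₂ n k l)
    (hε₁ : ∀ i, ε (S.leg (Sum.inl i)) = ε₁ i.castSucc)
    (hε₂ : ∀ j, ε (S.leg (Sum.inr j)) = ε₂ j.castSucc)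
    (X₁ : Wiring r₁ ε₁) (X₂ : Wiring r₂ ε₂) : ∃ X : Wiring r ε, IsGlue S X X₁ X₂ := by
  let leg' : Fin k ⊕ Fin l → H₁ ⊕ H₂ :=
    Sum.map (fun i => X₁.leg i.castSucc) (fun j => X₂.leg j.castSucc)
  have hleg' : Function.Injective leg' :=
    Function.Injective.sumMap (X₁.leg_injective.comp (Fin.castSucc_injective k))
      (X₂.leg_injective.comp (Fin.castSucc_injective l))
  have hfix : ∀ h, gluePair X₁ X₂ h = h ↔ h ∈ Set.range leg' := by
    rintro (a | b)
    · by_cases ha : a = X₁.leg (Fin.last k)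
      · simp [gluePair, ha, leg', X₁.leg_injective.eq_iff, Fin.ext_iff, Fin.is_lt _ |>.ne]
      · simp [gluePair, ha, leg', X₁.pair_eq_iff,
          ← mem_range_iff_castSucc ha]
    · by_cases hb : b = X₂.leg (Fin.last l)
      · simp [gluePair, hb, leg', X₂.leg_injective.eq_iff, Fin.ext_iff, Fin.is_lt _ |>.ne]
      · simp [gluePair, hb, leg', X₂.pair_eq_iff,
          ← mem_range_iff_castSucc hb]
  refine ⟨{
    sign := fun v => Sum.elim X₁.sign X₂.sign (S.vert.symm v)
    pair := fun h => S.half (gluePair X₁ X₂ (S.half.symm h))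
    leg := fun i => S.half (leg' (S.leg.symm i))
    pair_pair := fun h => by simp [gluePair_gluePair]
    leg_injective := S.half.injective.comp (hleg'.comp S.leg.symm.injective)
    pair_eq_iff := fun h => ?_
    sign_leg := fun i => ?_ }, ?_⟩
  · obtain ⟨h, rfl⟩ := S.half.surjective h
    rw [Equiv.symm_apply_apply, S.half.injective.eq_iff, hfix]
    constructor
    · rintro ⟨i, rfl⟩
      exact ⟨S.leg i, by simp⟩
    · rintro ⟨i, hi⟩
      exact ⟨_, S.half.injective hi⟩
  · obtain ⟨i | j, rfl⟩ := S.leg.surjective i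
    · simp [leg', X₁.sign_leg, hε₁]
    · simp [leg', X₂.sign_leg, hε₂]
  · constructor
    · simp
    · simp
    · simp [leg']
    · simp [leg']
    · intro h hh; simp [gluePair, hh]
    · intro h hh; simp [gluePair, hh]
    · simp [gluePair]

theorem IsGlue.unique {S : Splitting r r₁ r₂ n k l} {X Y : Wiring r ε} {X₁ : Wiring r₁ ε₁}
    {X₂ : Wiring r₂ ε₂} (g : IsGlue S X X₁ X₂) (g' : IsGlue S Y X₁ X₂) : X = Y := by
  ext1
  · funext v
    rcases S.vert_cases v with ⟨v, rfl⟩ | ⟨v, rfl⟩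
    · rw [g.sign_left, g'.sign_left]
    · rw [g.sign_right, g'.sign_right]
  · funext h
    rcases S.half_cases h with ⟨a, rfl⟩ | ⟨b, rfl⟩
    · by_cases ha : a = X₁.leg (Fin.last k)
      · rw [ha, g.pair_last, g'.pair_last]
      · rw [g.pair_left a ha, g'.pair_left a ha]
    · by_cases hb : b = X₂.leg (Fin.last l)
      · rw [hb, g.pair_last', g'.pair_last']
      · rw [g.pair_right b hb, g'.pair_right b hb]
  · funext i
    obtain ⟨i | j, rfl⟩ := S.leg.surjective i
    · rw [g.leg_left, g'.leg_left]
    · rw [g.leg_right, g'.leg_right]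

/-- The part of a diagram on one side of an edge. -/
theorem Wiring.exists_part (S : Splitting r r₁ r₂ n k l)
    (hε₁ : ∀ i, ε (S.leg (Sum.inl i)) = ε₁ i.castSucc) (hlast : ε₁ (Fin.last k) = 1)
    (X : Wiring r ε) {a : H₁} (hp : r (X.pair (S.half (Sum.inl a))) ∉ S.left)
    (hsign : X.sign (r (S.half (Sum.inl a))) = 1)
    (hpair : ∀ a' ≠ a, r (X.pair (S.half (Sum.inl a'))) ∈ S.left)
    (hleft : ∀ i, r (X.leg (S.leg (Sum.inl i))) ∈ S.left)
    (hright : ∀ j, r (X.leg (S.leg (Sum.inr j))) ∉ S.left) :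
    ∃ X₁ : Wiring r₁ ε₁, X₁.leg (Fin.last k) = a ∧
      (∀ v, X.sign (S.vert (Sum.inl v)) = X₁.sign v) ∧
      (∀ i : Fin k, X.leg (S.leg (Sum.inl i)) = S.half (Sum.inl (X₁.leg i.castSucc))) ∧
      ∀ h, h ≠ a → X.pair (S.half (Sum.inl h)) = S.half (Sum.inl (X₁.pair h)) := by
  classical
  have hex : ∀ h, r h ∈ S.left → ∃ a', h = S.half (Sum.inl a') := by
    intro h hh
    rcases S.half_cases h with h' | ⟨b, rfl⟩
    · exact h'
    · rw [S.root_inr] at hh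
      exact absurd hh (S.inr_notMem_left _)
  have hinj := IsGlue.half_inl_injective S
  -- The pairing of the part: that of `X`, except that the cut half-edge `a` becomes a fixed point
  -- and so the new last leg.
  have hP : ∀ a', ∃ c, (a' = a → c = a) ∧
      (a' ≠ a → X.pair (S.half (Sum.inl a')) = S.half (Sum.inl c)) := by
    intro a'
    by_cases h : a' = a
    · exact ⟨a, by simp [h]⟩
    · obtain ⟨c, hc⟩ := hex _ (hpair a' h)
      exact ⟨c, fun h' => absurd h' h, fun _ => hc⟩
  choose P hPa hP using hP
  choose lg hlg using fun i => hex _ (hleft i)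
  have hlga : ∀ i, lg i ≠ a := by
    rintro i rfl
    rw [← hlg, X.pair_leg] at hp
    exact hp (hleft i)
  have hPne : ∀ a' ≠ a, P a' ≠ a := by
    intro a' h h'
    have := hP a' h
    rw [h'] at this
    apply hp
    rw [← this, X.pair_pair]
    simp
  refine ⟨{
    sign := fun v => X.sign (S.vert (Sum.inl v))
    pair := P
    leg := Fin.snoc (α := fun _ => H₁) lg a
    pair_pair := fun a' => ?_
    leg_injective := ?_
    pair_eq_iff := fun a' => ?_
    sign_leg := fun i => ?_ }, by simp, fun v => rfl, fun i => by simp [hlg], fun h hh => hP h hh⟩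
  · by_cases h : a' = a
    · rw [hPa a' h, hPa a rfl, h]
    · apply hinj
      change S.half _ = S.half _
      rw [← hP _ (hPne a' h), ← hP a' h, X.pair_pair]
  · rw [Fin.snoc_injective_iff]
    refine ⟨fun i j hij => ?_, by rintro ⟨i, hi⟩; exact hlga i hi⟩
    have : X.leg (S.leg (Sum.inl i)) = X.leg (S.leg (Sum.inl j)) := by rw [hlg, hlg, hij]
    simpa using X.leg_injective this
  · by_cases h : a' = a
    · subst h
      simp only [hPa a' rfl, true_iff]
      exact ⟨Fin.last k, by simp⟩
    · have h1 : P a' = a' ↔ ∃ i, lg i = a' := by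
        rw [← hinj.eq_iff]
        rw [← hP a' h, X.pair_eq_iff]
        constructor
        · rintro ⟨i, hi⟩
          obtain ⟨i | j, rfl⟩ := S.leg.surjective i
          · exact ⟨i, hinj ((hlg i).symm.trans hi)⟩
          · refine absurd ?_ (hright j)
            rw [hi]; simp
        · rintro ⟨i, rfl⟩
          exact ⟨_, hlg i⟩
      rw [h1]
      constructor
      · rintro ⟨i, rfl⟩
        exact ⟨i.castSucc, by simp⟩
      · rintro ⟨i, rfl⟩
        induction i using Fin.lastCases with
        | last => simp at h
        | cast i => exact ⟨i, by simp⟩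
  · induction i using Fin.lastCases with
    | last => simpa [hlast] using hsign
    | cast i =>
      have := X.sign_leg (S.leg (Sum.inl i))
      rw [hlg, S.root_inl] at this
      simpa [hε₁] using this

theorem Wiring.Separates.exists_isGlue {S : Splitting r r₁ r₂ n k l}
    (hε₁ : ∀ i, ε (S.leg (Sum.inl i)) = ε₁ i.castSucc) (hlast₁ : ε₁ (Fin.last k) = 1)
    (hε₂ : ∀ j, ε (S.leg (Sum.inr j)) = ε₂ j.castSucc) (hlast₂ : ε₂ (Fin.last l) = 1)
    {X : Wiring r ε} {h : H} (hs : X.Separates S.leg h) (hside : X.side h = S.left) :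
    ∃ (X₁ : Wiring r₁ ε₁) (X₂ : Wiring r₂ ε₂), IsGlue S X X₁ X₂ ∧
      h = S.half (Sum.inl (X₁.leg (Fin.last k))) := by
  have hR := hs.right_notMem_side
  obtain ⟨-, s1, s2, hn, hL, -⟩ := X.separates_iff.1 hs
  have hr := X.root_mem_side h
  have hpm : ∀ g, g ≠ h → g ≠ X.pair h → (r (X.pair g) ∈ S.left ↔ r g ∈ S.left) := by
    intro g g1 g2
    rw [← hside]
    exact X.pair_mem_side_iff g1 g2
  rw [hside] at hR hn hL hr
  obtain ⟨a, rfl⟩ : ∃ a, h = S.half (Sum.inl a) := by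
    rcases S.half_cases h with h' | ⟨b, rfl⟩
    · exact h'
    · rw [S.root_inr] at hr
      exact absurd hr (S.inr_notMem_left _)
  obtain ⟨b, hb⟩ : ∃ b, X.pair (S.half (Sum.inl a)) = S.half (Sum.inr b) := by
    rcases S.half_cases (X.pair (S.half (Sum.inl a))) with ⟨c, hc⟩ | h'
    · rw [hc, S.root_inl] at hn
      exact absurd (S.inl_mem_left _) hn
    · exact h'
  have hb' : X.pair (S.half (Sum.inr b)) = S.half (Sum.inl a) := by rw [← hb, X.pair_pair]
  rw [hb] at hpm s2
  obtain ⟨X₁, l1, g1, g2, g3⟩ := X.exists_part S hε₁ hlast₁ hn s1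
    (fun a' ha' => (hpm _ (by simpa using ha') (by simp)).2 (by simp)) hL hR
  obtain ⟨X₂, l2, g1', g2', g3'⟩ := X.exists_part S.swap hε₂ hlast₂ (a := b)
    (by rw [S.left_swap, S.swap_half_inl, hb']; simp) s2
    (fun b' hb' => by
      rw [S.left_swap, Set.mem_compl_iff, S.swap_half_inl, hpm _ (by simp) (by simpa using hb')]
      simp)
    (fun i => by rw [S.left_swap]; exact hR i) (fun j => by rw [S.left_swap]; simpa using hL j)
  subst l1 l2
  exact ⟨X₁, X₂, ⟨g1, g1', g2, g2', g3, g3', hb⟩, rfl⟩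

theorem IsGlue.eq_right {S : Splitting r r₁ r₂ n k l} {X : Wiring r ε} {X₁ Y₁ : Wiring r₁ ε₁}
    {X₂ Y₂ : Wiring r₂ ε₂} (g : IsGlue S X X₁ X₂) (g' : IsGlue S X Y₁ Y₂)
    (h : X₁.leg (Fin.last k) = Y₁.leg (Fin.last k)) : X₂ = Y₂ := by
  refine g.swap.eq_left g'.swap (Sum.inr_injective (S.half.injective ?_))
  rw [← g.pair_last, ← g'.pair_last, h]

end GGreen

/-! ### Loop momenta: the integral does not depend on their choice -/

namespace GGreen

section IntegralMaps

variable {ι ι' : Type*} [Fintype ι] [Fintype ι'] {D : ℕ}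

/-- The vector of momenta with the given integral components. -/
def ofInt (z : ι → Fin D → ℤ) : ι → Momentum D := fun i j => z i j

/-- The standard basis vectors are integral, so the matrix of `f` in this basis has integer entries.
-/
theorem exists_int_eq_det (f : (ι → Momentum D) →ₗ[ℝ] (ι → Momentum D))
    (hf : ∀ z : ι → Fin D → ℤ, ∃ z' : ι → Fin D → ℤ, f (ofInt z) = ofInt z') :
    ∃ c : ℤ, LinearMap.det f = c := by
  classical
  let b := Pi.basis fun _ : ι => Pi.basisFun ℝ (Fin D)
  have hb : ∀ j, b j = ofInt (Pi.single j.1 (Pi.single j.2 1)) := by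
    rintro ⟨i, d⟩
    simp only [b, Pi.basis_apply, Pi.basisFun_apply]
    funext i' d'
    by_cases hi : i' = i
    · subst hi
      by_cases hd : d' = d
      · subst hd; simp [ofInt]
      · simp [ofInt, hd]
    · simp [ofInt, hi]
  choose Z hZ using hf
  refine ⟨(Matrix.of fun i j => Z (Pi.single j.1 (Pi.single j.2 1)) i.1 i.2 :
    Matrix (Σ _ : ι, Fin D) (Σ _ : ι, Fin D) ℤ).det, ?_⟩
  rw [Int.cast_det, ← LinearMap.det_toMatrix b]
  congr 1
  ext i j
  rw [LinearMap.toMatrix_apply, hb, hZ]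
  simp [b, Pi.basis_repr, ofInt]

/-- A linear map which is bijective on vectors with integral components preserves volume. -/
theorem measurePreserving_of_integral (f : (ι → Momentum D) ≃ₗ[ℝ] (ι → Momentum D))
    (hf : ∀ z : ι → Fin D → ℤ, ∃ z' : ι → Fin D → ℤ, f (ofInt z) = ofInt z')
    (hf' : ∀ z : ι → Fin D → ℤ, ∃ z' : ι → Fin D → ℤ, f.symm (ofInt z) = ofInt z') :
    MeasurePreserving f volume volume := by
  obtain ⟨c, hc⟩ := exists_int_eq_det (f : (ι → Momentum D) →ₗ[ℝ] (ι → Momentum D)) hf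
  obtain ⟨c', hc'⟩ := exists_int_eq_det (f.symm : (ι → Momentum D) →ₗ[ℝ] (ι → Momentum D)) hf'
  have h1 := f.det_mul_det_symm
  rw [hc, hc'] at h1
  -- The two determinants are inverse integers, hence `±1`.
  have h2 : c * c' = 1 := by exact_mod_cast h1
  have h3 : |(c : ℝ)| = 1 := by
    have := Int.isUnit_iff_abs_eq.1 (IsUnit.of_mul_eq_one c' h2)
    exact_mod_cast this
  have hdet : LinearMap.det (f : (ι → Momentum D) →ₗ[ℝ] (ι → Momentum D)) ≠ 0 := by
    rw [hc]
    intro h0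
    rw [h0] at h3
    simp at h3
  refine ⟨(LinearMap.continuous_of_finiteDimensional
    (f : (ι → Momentum D) →ₗ[ℝ] (ι → Momentum D))).measurable, ?_⟩
  have := Measure.map_linearMap_addHaar_eq_smul_addHaar (volume : Measure (ι → Momentum D)) hdet
  rw [hc, abs_inv, h3] at this
  simpa using this

theorem measurePreserving_of_integral' (σ : ι ≃ ι')
    (f : (ι → Momentum D) ≃ₗ[ℝ] (ι' → Momentum D))
    (hf : ∀ z : ι → Fin D → ℤ, ∃ z' : ι' → Fin D → ℤ, f (ofInt z) = ofInt z')
    (hf' : ∀ z : ι' → Fin D → ℤ, ∃ z' : ι → Fin D → ℤ, f.symm (ofInt z) = ofInt z') :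
    MeasurePreserving f volume volume := by
  have h := measurePreserving_of_integral (f.trans (LinearEquiv.funCongrLeft ℝ (Momentum D) σ))
    (fun z => by
      obtain ⟨z', hz'⟩ := hf z
      exact ⟨z' ∘ σ, by simp only [LinearEquiv.trans_apply, hz']; rfl⟩)
    (fun z => by
      obtain ⟨z', hz'⟩ := hf' (z ∘ σ.symm)
      exact ⟨z', by rw [← hz']; rfl⟩)
  have h2 := (volume_measurePreserving_piCongrLeft (fun _ => Momentum D) σ).comp h
  convert h2 using 1
  funext y i
  obtain ⟨i, rfl⟩ := σ.surjective i
  simp only [Function.comp_apply, MeasurableEquiv.coe_piCongrLeft, Equiv.piCongrLeft_apply_apply]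
  rfl

end IntegralMaps

namespace Wiring

variable {V H : Type*} [Fintype H] {r : H → V} {n : ℕ} {ε : Fin n → ℤˣ}

open Classical in
/-- `x h` is the momentum entering through `h`. It is prescribed on the legs, opposite on the two
ends of an edge, and conserved at each vertex. -/
def Conserves {A : Type*} [AddCommGroup A] (X : Wiring r ε) (p : Fin n → A) (x : H → A) : Prop :=
  (∀ i, x (X.leg i) = p i) ∧ (∀ h, X.pair h ≠ h → x (X.pair h) = - x h) ∧
  ∀ v, ∑ h with r h = v, x h = 0

/-- The momenta of the half-edges `b i` can be prescribed freely and determine all others. -/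
def IsLoopBasis {ι : Type*} (X : Wiring r ε) (b : ι → H) : Prop :=
  ∀ (A : Type) [AddCommGroup A] (p : Fin n → A), ∑ i, p i = 0 →
    ∀ y : ι → A, ∃! x : H → A, X.Conserves p x ∧ ∀ i, x (b i) = y i

/-- The sum of `x` over all half-edges vanishes vertex by vertex. In it the two halves of each
internal edge cancel, which leaves the legs. -/
theorem Conserves.sum_eq_zero {A : Type*} [AddCommGroup A] {X : Wiring r ε} {p : Fin n → A}
    {x : H → A} (hx : X.Conserves p x) : ∑ i, p i = 0 := by
  classical
  obtain ⟨h1, h2, h3⟩ := hx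
  have htot : ∑ h, x h = 0 := by
    rw [← Finset.sum_fiberwise_of_maps_to (t := Finset.univ.image r) (g := r)
      fun h _ => Finset.mem_image_of_mem r (Finset.mem_univ h)]
    exact Finset.sum_eq_zero fun v _ => by convert h3 v
  rw [← Finset.sum_filter_add_sum_filter_not Finset.univ (fun h => X.pair h = h)] at htot
  have hint : ∑ h with ¬ X.pair h = h, x h = 0 := by
    refine Finset.sum_involution (fun h _ => X.pair h) ?_ ?_ ?_ ?_
    · intro h hh
      rw [h2 h (Finset.mem_filter.1 hh).2, add_neg_cancel]
    · intro h hh _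
      exact (Finset.mem_filter.1 hh).2
    · intro h hh
      have := (Finset.mem_filter.1 hh).2
      simpa [X.pair_pair, eq_comm] using this
    · intro h _
      exact X.pair_pair h
  rw [hint, add_zero] at htot
  rw [← htot]
  refine Finset.sum_bij (fun i _ => X.leg i) ?_ ?_ ?_ ?_
  · intro i _; simp [X.pair_leg]
  · intro i _ j _ h; exact X.leg_injective h
  · intro h hh
    obtain ⟨i, hi⟩ := (X.pair_eq_iff h).1 (Finset.mem_filter.1 hh).2
    exact ⟨i, Finset.mem_univ _, hi⟩
  · intro i _; exact (h1 i).symm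

theorem Conserves.add {A : Type*} [AddCommGroup A] {X : Wiring r ε} {p q : Fin n → A}
    {x y : H → A} (hx : X.Conserves p x) (hy : X.Conserves q y) :
    X.Conserves (p + q) (x + y) := by
  refine ⟨fun i => by simp [hx.1, hy.1], fun h hh => ?_, fun v => ?_⟩
  · simp only [Pi.add_apply, hx.2.1 h hh, hy.2.1 h hh]; abel
  · simp [Finset.sum_add_distrib, hx.2.2 v, hy.2.2 v]

theorem Conserves.map {A B : Type*} [AddCommGroup A] [AddCommGroup B] (f : A →+ B)
    {X : Wiring r ε} {p : Fin n → A} {x : H → A} (hx : X.Conserves p x) :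
    X.Conserves (fun i => f (p i)) fun h => f (x h) := by
  refine ⟨fun i => by simp [hx.1], fun h hh => ?_, fun v => ?_⟩
  · simp [hx.2.1 h hh]
  · rw [← map_sum, hx.2.2 v, map_zero]

/-- The solutions of the conservation laws without external momenta. -/
def cycles (R A : Type*) [Ring R] [AddCommGroup A] [Module R A] (X : Wiring r ε) :
    Submodule R (H → A) where
  carrier := {x | X.Conserves 0 x}
  zero_mem' := ⟨fun _ => rfl, fun _ _ => by simp, fun _ => by simp⟩
  add_mem' hx hy := by simpa using hx.add hy
  smul_mem' c x hx := by
    have := Conserves.map (DistribSMul.toAddMonoidHom A c) hx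
    simp only [Pi.zero_apply, map_zero] at this
    exact this

theorem mem_cycles {R A : Type*} [Ring R] [AddCommGroup A] [Module R A] {X : Wiring r ε}
    {x : H → A} : x ∈ X.cycles R A ↔ X.Conserves 0 x := Iff.rfl

variable {ι ι' : Type*}

/-- Loop momenta are coordinates on the solutions. -/
def IsLoopBasis.equiv (R : Type*) (A : Type) [Ring R] [AddCommGroup A] [Module R A]
    {X : Wiring r ε} {b : ι → H} (hb : X.IsLoopBasis b) : X.cycles R A ≃ₗ[R] (ι → A) :=
  LinearEquiv.ofBijective
    { toFun := fun x i => x.1 (b i)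
      map_add' := fun _ _ => rfl
      map_smul' := fun _ _ => rfl }
    (by
      constructor
      · intro x x' h
        exact Subtype.ext ((hb A 0 (by simp) fun i => x.1 (b i)).unique
          ⟨x.2, fun _ => rfl⟩ ⟨x'.2, fun i => (congrFun h i).symm⟩)
      · intro y
        obtain ⟨x, ⟨hx, hxy⟩, -⟩ := hb A 0 (by simp) y
        exact ⟨⟨x, hx⟩, funext hxy⟩)

theorem IsLoopBasis.equiv_apply (R : Type*) (A : Type) [Ring R] [AddCommGroup A] [Module R A]
    {X : Wiring r ε} {b : ι → H} (hb : X.IsLoopBasis b) (x : X.cycles R A) (i : ι) :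
    hb.equiv R A x i = x.1 (b i) := rfl

/-- Momenta `1` on `b i` and `0` on every other `b j` can be prescribed over `ℤ`. -/
theorem IsLoopBasis.injective {X : Wiring r ε} {b : ι → H} (hb : X.IsLoopBasis b) :
    Function.Injective b := by
  classical
  intro i j hij
  by_contra hne
  obtain ⟨x, ⟨-, hx⟩, -⟩ := hb ℤ 0 (by simp) (Pi.single i 1)
  have h1 := hx i
  have h2 := hx j
  rw [Pi.single_eq_same] at h1
  rw [Pi.single_eq_of_ne (Ne.symm hne), ← hij, h1] at h2
  exact one_ne_zero h2

theorem IsLoopBasis.reindex {X : Wiring r ε} {b : ι → H} (hb : X.IsLoopBasis b) (σ : ι' ≃ ι) :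
    X.IsLoopBasis (b ∘ σ) := by
  intro A _ p hp y
  obtain ⟨x, ⟨hx, hxy⟩, hu⟩ := hb A p hp (y ∘ σ.symm)
  refine ⟨x, ⟨hx, fun i => by simp [hxy]⟩, fun x' hx' => hu x' ⟨hx'.1, fun i => ?_⟩⟩
  have := hx'.2 (σ.symm i)
  simpa using this

theorem IsLoopBasis.range {X : Wiring r ε} {b : ι → H} (hb : X.IsLoopBasis b) :
    X.IsLoopBasis (Subtype.val : Set.range b → H) := by
  have := hb.reindex (Equiv.ofInjective b hb.injective).symm
  convert this using 1
  funext ⟨_, i, rfl⟩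
  simp [Equiv.ofInjective_symm_apply hb.injective]

variable {D : ℕ}

/-- The definition of a loop basis quantifies over all abelian groups. Solving the conservation laws
over the integers gives, by uniqueness over the reals, the real solution with these loop momenta;
its other coordinates are thus integral. -/
theorem IsLoopBasis.integral {X : Wiring r ε} {b : ι → H} {b' : ι' → H}
    (hb : X.IsLoopBasis b) (hb' : X.IsLoopBasis b') (z : ι → Fin D → ℤ) :
    ∃ z' : ι' → Fin D → ℤ,
      ((hb.equiv ℝ (Momentum D)).symm.trans (hb'.equiv ℝ (Momentum D))) (ofInt z) =
        ofInt z' := by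
  obtain ⟨x, ⟨hx, hxz⟩, -⟩ := hb (Fin D → ℤ) 0 (by simp) z
  have hx' := Conserves.map ((Int.castAddHom ℝ).compLeft (Fin D)) hx
  have hmem : (fun h => (Int.castAddHom ℝ).compLeft (Fin D) (x h)) ∈ X.cycles ℝ (Momentum D) := by
    rw [mem_cycles]
    convert hx' using 1
    funext i
    simp
  have hz : (hb.equiv ℝ (Momentum D)).symm (ofInt z) = ⟨_, hmem⟩ := by
    rw [LinearEquiv.symm_apply_eq]
    funext i
    change ofInt z i = fun d => ((x (b i) d : ℤ) : ℝ)
    rw [hxz]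
    rfl
  refine ⟨fun i => x (b' i), ?_⟩
  rw [LinearEquiv.trans_apply, hz]
  rfl

variable [Fintype ι] [Fintype ι']

/-- Both index sets have as many elements as the dimension of the real cycle space. -/
theorem IsLoopBasis.nonempty_equiv {X : Wiring r ε} {b : ι → H} {b' : ι' → H}
    (hb : X.IsLoopBasis b) (hb' : X.IsLoopBasis b') : Nonempty (ι ≃ ι') := by
  have := ((hb.equiv ℝ ℝ).symm.trans (hb'.equiv ℝ ℝ)).finrank_eq
  rw [Module.finrank_fintype_fun_eq_card, Module.finrank_fintype_fun_eq_card] at this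
  exact ⟨Fintype.equivOfCardEq this⟩

/-- The change of loop momenta preserves volume. -/
theorem IsLoopBasis.measurePreserving {X : Wiring r ε} {b : ι → H} {b' : ι' → H}
    (hb : X.IsLoopBasis b) (hb' : X.IsLoopBasis b') :
    MeasurePreserving ((hb.equiv ℝ (Momentum D)).symm.trans (hb'.equiv ℝ (Momentum D)))
      volume volume := by
  obtain ⟨σ⟩ := hb.nonempty_equiv hb'
  exact measurePreserving_of_integral' σ _ (hb.integral hb') (hb'.integral hb)

open Classical in
/-- The integral of `F` over the loop momenta carried by the half-edges `b i`. -/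
def loopIntegral (X : Wiring r ε) (F : (H → Momentum D) → ℂ) (p : Fin n → Momentum D)
    (b : ι → H) : ℂ :=
  ∫ y : ι → Momentum D,
    if hx : ∃ x : H → Momentum D, X.Conserves p x ∧ ∀ i, x (b i) = y i then F hx.choose else 0

/-- For a loop basis and conserved external momenta the solution always exists and is unique, so the
default value `0` never occurs and the chosen solution may be replaced by an explicit one. -/
theorem loopIntegral_eq {X : Wiring r ε} (F : (H → Momentum D) → ℂ) {p : Fin n → Momentum D}
    (hp : ∑ i, p i = 0) {b : ι → H} (hb : X.IsLoopBasis b)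
    {x : (ι → Momentum D) → H → Momentum D} (hx : ∀ y, X.Conserves p (x y))
    (hxy : ∀ y i, x y (b i) = y i) : X.loopIntegral F p b = ∫ y, F (x y) := by
  refine integral_congr_ae (Filter.Eventually.of_forall fun y => ?_)
  have hex : ∃ x : H → Momentum D, X.Conserves p x ∧ ∀ i, x (b i) = y i :=
    ⟨x y, hx y, hxy y⟩
  simp only [dif_pos hex]
  rw [(hb _ p hp y).unique hex.choose_spec ⟨hx y, hxy y⟩]

theorem loopIntegral_eq_cycles {X : Wiring r ε} (F : (H → Momentum D) → ℂ)
    {p : Fin n → Momentum D} {b : ι → H} (hb : X.IsLoopBasis b) {x : H → Momentum D}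
    (hx : X.Conserves p x) :
    X.loopIntegral F p b = ∫ y, F (x + ((hb.equiv ℝ (Momentum D)).symm y).1) := by
  -- Translation by the loop momenta of the particular solution `x` reduces to solutions without
  -- external momenta.
  rw [← integral_sub_right_eq_self _ fun i => x (b i)]
  refine loopIntegral_eq F hx.sum_eq_zero hb (fun y => ?_) fun y i => ?_
  · simpa using hx.add ((hb.equiv ℝ (Momentum D)).symm (y - fun i => x (b i))).2
  · rw [Pi.add_apply, ← hb.equiv_apply ℝ (Momentum D), LinearEquiv.apply_symm_apply]
    simp

theorem loopIntegral_congr {X : Wiring r ε} (F : (H → Momentum D) → ℂ) {p : Fin n → Momentum D}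
    (hp : ∑ i, p i = 0) {b : ι → H} {b' : ι' → H} (hb : X.IsLoopBasis b)
    (hb' : X.IsLoopBasis b') : X.loopIntegral F p b = X.loopIntegral F p b' := by
  obtain ⟨x, ⟨hx, -⟩, -⟩ := hb (Momentum D) p hp 0
  rw [loopIntegral_eq_cycles F hb hx, loopIntegral_eq_cycles F hb' hx]
  have hm := hb.measurePreserving (D := D) hb'
  let f := ((hb.equiv ℝ (Momentum D)).symm.trans (hb'.equiv ℝ (Momentum D)))
  -- For a measurable equivalence the change of variables needs no measurability of `F`.
  let f' := f.toContinuousLinearEquiv.toHomeomorph.toMeasurableEquiv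
  have h2 : MeasurePreserving f' volume volume := hm
  rw [← h2.integral_comp']
  congr 1
  funext y
  congr 3
  change _ = (hb'.equiv ℝ (Momentum D)).symm (hb'.equiv ℝ (Momentum D) _)
  rw [LinearEquiv.symm_apply_apply]
  rfl

end Wiring

end GGreen

/-! ### Factorization of the Feynman integral at the joining edge -/

namespace GGreen

namespace Wiring

variable {V H : Type*} [Fintype H] {r : H → V} {n : ℕ} {ε : Fin n → ℤˣ} {D : ℕ}

open Classical in
/-- The internal edges. -/
def edges (X : Wiring r ε) : Finset (Sym2 H) :=
  (Finset.univ.filter fun h => X.pair h ≠ h).image fun h => s(h, X.pair h)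

theorem mem_edges {X : Wiring r ε} {z : Sym2 H} :
    z ∈ X.edges ↔ ∃ h, X.pair h ≠ h ∧ s(h, X.pair h) = z := by
  simp [edges]

/-- The factor of an edge, computed from an arbitrary one of its ends. -/
def edgeFactor (G : ℤˣ → ℤˣ → Momentum D → ℂ) (X : Wiring r ε) (x : H → Momentum D)
    (z : Sym2 H) : ℂ :=
  G (X.sign (r (Quot.out z).1)) (X.sign (r (X.pair (Quot.out z).1))) (x (Quot.out z).1)

/-- The product of all vertices and propagators. -/
def integrand [Fintype V] (W : V → ℤˣ → (H → Momentum D) → ℂ) (G : ℤˣ → ℤˣ → Momentum D → ℂ)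
    (X : Wiring r ε) (x : H → Momentum D) : ℂ :=
  (∏ v, W v (X.sign v) x) * ∏ z ∈ X.edges, X.edgeFactor G x z

/-- If the end picked by `Quot.out` is the other one, the momentum changes sign and the two types
are exchanged; `hG` says that this has no effect. -/
theorem edgeFactor_mk {G : ℤˣ → ℤˣ → Momentum D → ℂ} (hG : ∀ a b q, G a b (-q) = G b a q)
    {X : Wiring r ε} {p : Fin n → Momentum D} {x : H → Momentum D} (hx : X.Conserves p x) {h : H}
    (hh : X.pair h ≠ h) :
    X.edgeFactor G x s(h, X.pair h) = G (X.sign (r h)) (X.sign (r (X.pair h))) (x h) := by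
  have hout : s((Quot.out s(h, X.pair h)).1, (Quot.out s(h, X.pair h)).2) = s(h, X.pair h) :=
    Quot.out_eq _
  rw [edgeFactor]
  rcases Sym2.eq_iff.1 hout with ⟨h1, -⟩ | ⟨h1, -⟩
  · rw [h1]
  · rw [h1, X.pair_pair, hx.2.1 h hh, hG]

open Classical in
/-- The Feynman integral of a diagram. -/
def value [Fintype V] (W : V → ℤˣ → (H → Momentum D) → ℂ) (G : ℤˣ → ℤˣ → Momentum D → ℂ)
    (X : Wiring r ε) (p : Fin n → Momentum D) : ℂ :=
  if hL : ∃ L : Set H, X.IsLoopBasis (Subtype.val : L → H) then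
    X.loopIntegral (X.integrand W G) p (Subtype.val : hL.choose → H)
  else 0

theorem value_eq [Fintype V] {W : V → ℤˣ → (H → Momentum D) → ℂ}
    {G : ℤˣ → ℤˣ → Momentum D → ℂ} {X : Wiring r ε} {p : Fin n → Momentum D}
    (hp : ∑ i, p i = 0) {ι : Type*} [Fintype ι] {b : ι → H} (hb : X.IsLoopBasis b) :
    X.value W G p = X.loopIntegral (X.integrand W G) p b := by
  have hL : ∃ L : Set H, X.IsLoopBasis (Subtype.val : L → H) := ⟨_, hb.range⟩
  classical
  rw [value, dif_pos hL]
  exact loopIntegral_congr _ hp hL.choose_spec hb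

end Wiring

theorem Splitting.sum_leg {V H V₁ H₁ V₂ H₂ A : Type*} [AddCommGroup A] {r : H → V} {r₁ : H₁ → V₁}
    {r₂ : H₂ → V₂} {n k l : ℕ} (S : Splitting r r₁ r₂ n k l) (p : Fin n → A) :
    ∑ i, p i = ∑ i, p (S.leg (Sum.inl i)) + ∑ j, p (S.leg (Sum.inr j)) := by
  rw [← S.leg.sum_comp, Fintype.sum_sum_type]

namespace IsGlue

variable {V H V₁ H₁ V₂ H₂ : Type*} [Fintype H] [Fintype H₁]
  {r : H → V} {r₁ : H₁ → V₁} {r₂ : H₂ → V₂} {n k l : ℕ}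
  {ε : Fin n → ℤˣ} {ε₁ : Fin (k + 1) → ℤˣ} {ε₂ : Fin (l + 1) → ℤˣ}
  {S : Splitting r r₁ r₂ n k l} {X : Wiring r ε} {X₁ : Wiring r₁ ε₁} {X₂ : Wiring r₂ ε₂}

variable {D : ℕ}

/-- The ends picked in `X` and in `X₁` need not correspond, so both factors are evaluated at the
same half-edge first. -/
theorem edgeFactor_left {G : ℤˣ → ℤˣ → Momentum D → ℂ} (hG : ∀ a b q, G a b (-q) = G b a q)
    (g : IsGlue S X X₁ X₂) {p : Fin n → Momentum D} {p₁ : Fin (k + 1) → Momentum D}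
    {x : H → Momentum D} (hx : X.Conserves p x)
    (hx₁ : X₁.Conserves p₁ fun a => x (S.half (Sum.inl a))) {z : Sym2 H₁} (hz : z ∈ X₁.edges) :
    X.edgeFactor G x (z.map fun a => S.half (Sum.inl a)) =
      X₁.edgeFactor G (fun a => x (S.half (Sum.inl a))) z := by
  obtain ⟨a, ha, rfl⟩ := Wiring.mem_edges.1 hz
  have h2 := g.pair_left a (by rintro rfl; exact ha (X₁.pair_leg _))
  rw [Wiring.edgeFactor_mk hG hx₁ ha, Sym2.map_mk, ← h2,
    Wiring.edgeFactor_mk hG hx (by rw [h2]; simpa using ha), h2, S.root_inl, S.root_inl,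
    g.sign_left, g.sign_left]

variable [Fintype H₂]

section Conservation

variable {A : Type*} [AddCommGroup A] {p : Fin n → A} {p₁ : Fin (k + 1) → A}
  {p₂ : Fin (l + 1) → A}

open Classical in
theorem sum_root_inl (S : Splitting r r₁ r₂ n k l) (x : H → A) (v : V₁) :
    ∑ h with r h = S.vert (Sum.inl v), x h = ∑ a with r₁ a = v, x (S.half (Sum.inl a)) := by
  rw [Finset.sum_filter, Finset.sum_filter, ← S.half.sum_comp, Fintype.sum_sum_type]
  simp

/-- The momenta in a diagram are momenta in each of its parts. -/
theorem conserves_left (g : IsGlue S X X₁ X₂) (hp₁ : ∀ i, p (S.leg (Sum.inl i)) = p₁ i.castSucc)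
    (hs₁ : ∑ i, p₁ i = 0) {x : H → A} (hx : X.Conserves p x) :
    X₁.Conserves p₁ fun a => x (S.half (Sum.inl a)) := by
  have hc : X₁.Conserves (fun i => x (S.half (Sum.inl (X₁.leg i))))
      fun a => x (S.half (Sum.inl a)) := by
    refine ⟨fun _ => rfl, fun a ha => ?_, fun v => ?_⟩
    · have hlast : a ≠ X₁.leg (Fin.last k) := by
        rintro rfl
        exact ha (X₁.pair_leg _)
      have := hx.2.1 (S.half (Sum.inl a))
      rw [g.pair_left a hlast] at this
      exact this (by simpa using ha)
    · rw [← sum_root_inl, hx.2.2]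
  have hcast : ∀ i : Fin k, x (S.half (Sum.inl (X₁.leg i.castSucc))) = p₁ i.castSucc := by
    intro i
    rw [← g.leg_left, hx.1, hp₁]
  refine ⟨fun i => ?_, hc.2⟩
  induction i using Fin.lastCases with
  | cast i => exact hcast i
  | last =>
    -- The momentum of the last leg follows from overall conservation in the part.
    have h := hc.sum_eq_zero
    rw [← hs₁, Fin.sum_univ_castSucc, Fin.sum_univ_castSucc] at h
    simpa [hcast] using h

/-- Momenta in the parts define momenta in the whole diagram. -/
theorem conserves_glue (g : IsGlue S X X₁ X₂) (hp₁ : ∀ i, p (S.leg (Sum.inl i)) = p₁ i.castSucc)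
    (hp₂ : ∀ j, p (S.leg (Sum.inr j)) = p₂ j.castSucc)
    (hlast : p₂ (Fin.last l) = - p₁ (Fin.last k)) {x : H → A}
    (hx₁ : X₁.Conserves p₁ fun a => x (S.half (Sum.inl a)))
    (hx₂ : X₂.Conserves p₂ fun b => x (S.half (Sum.inr b))) : X.Conserves p x := by
  have e₁ : ∀ i, x (S.half (Sum.inl (X₁.leg i))) = p₁ i := hx₁.1
  have e₂ : ∀ i, x (S.half (Sum.inr (X₂.leg i))) = p₂ i := hx₂.1
  refine ⟨fun i => ?_, fun h hh => ?_, fun v => ?_⟩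
  · obtain ⟨i | j, rfl⟩ := S.leg.surjective i
    · rw [g.leg_left, e₁, hp₁]
    · rw [g.leg_right, e₂, hp₂]
  · rcases S.half_cases h with ⟨a, rfl⟩ | ⟨b, rfl⟩
    · rcases g.pair_inl_cases a with ⟨h1, -, h3⟩ | ⟨h1, h2⟩
      · rw [h3, h1, e₂, e₁, hlast]
      · rw [h2] at hh ⊢
        exact hx₁.2.1 a (by simpa using hh)
    · rcases g.pair_inr_cases b with ⟨h1, -, h3⟩ | ⟨h1, h2⟩
      · rw [h3, h1, e₁, e₂, hlast, neg_neg]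
      · rw [h2] at hh ⊢
        exact hx₂.2.1 b (by simpa using hh)
  · rcases S.vert_cases v with ⟨v, rfl⟩ | ⟨v, rfl⟩
    · rw [sum_root_inl, hx₁.2.2]
    · rw [← S.swap_vert_inl, sum_root_inl S.swap]
      exact hx₂.2.2 v

end Conservation

/-- The joining edge carries no loop: overall conservation in each part fixes its momentum to be `±∑
i, p (S.leg (Sum.inl i))`, after which the parts are solved separately. -/
theorem isLoopBasis_glue {ι₁ ι₂ : Type*} (g : IsGlue S X X₁ X₂) {b₁ : ι₁ → H₁} {b₂ : ι₂ → H₂}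
    (hb₁ : X₁.IsLoopBasis b₁) (hb₂ : X₂.IsLoopBasis b₂) :
    X.IsLoopBasis fun i => S.half (Sum.map b₁ b₂ i) := by
  intro A _ p hp y
  rw [S.sum_leg] at hp
  let p₁ : Fin (k + 1) → A :=
    Fin.snoc (α := fun _ => A) (fun i => p (S.leg (Sum.inl i))) (-∑ i, p (S.leg (Sum.inl i)))
  let p₂ : Fin (l + 1) → A :=
    Fin.snoc (α := fun _ => A) (fun i => p (S.leg (Sum.inr i))) (∑ i, p (S.leg (Sum.inl i)))
  have hp₁ : ∀ i, p (S.leg (Sum.inl i)) = p₁ i.castSucc := by simp [p₁]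
  have hp₂ : ∀ i, p (S.leg (Sum.inr i)) = p₂ i.castSucc := by simp [p₂]
  have hs₁ : ∑ i, p₁ i = 0 := by simp [p₁, Fin.sum_univ_castSucc]
  have hs₂ : ∑ i, p₂ i = 0 := by simpa [p₂, Fin.sum_univ_castSucc, add_comm] using hp
  obtain ⟨x₁, ⟨hx₁, hy₁⟩, hu₁⟩ := hb₁ A p₁ hs₁ fun i => y (Sum.inl i)
  obtain ⟨x₂, ⟨hx₂, hy₂⟩, hu₂⟩ := hb₂ A p₂ hs₂ fun i => y (Sum.inr i)
  refine ⟨fun h => Sum.elim x₁ x₂ (S.half.symm h), ⟨?_, ?_⟩, ?_⟩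
  · refine g.conserves_glue hp₁ hp₂ (by simp [p₁, p₂]) ?_ ?_
    · simpa using hx₁
    · simpa using hx₂
  · rintro (i | i)
    · simpa using hy₁ i
    · simpa using hy₂ i
  · rintro x ⟨hx, hy⟩
    have h1 := hu₁ _ ⟨g.conserves_left hp₁ hs₁ hx, fun i => hy (Sum.inl i)⟩
    have h2 := hu₂ _ ⟨g.swap.conserves_left hp₂ hs₂ hx, fun i => hy (Sum.inr i)⟩
    funext h
    rcases S.half_cases h with ⟨a, rfl⟩ | ⟨b, rfl⟩
    · simpa using congrFun h1 a
    · simpa using congrFun h2 b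

/-- Shows that a whole with a loop basis has parts with loop bases, so that the default value `0` of
the integral is compatible with factorization. The momentum of the cut leg is continued through the
second part to its first leg, which exists by `hl`, and the loop momenta there are set to `0`. -/
theorem isLoopBasis_left (hl : 0 < l) (g : IsGlue S X X₁ X₂) {L : Set H}
    (hL : X.IsLoopBasis (Subtype.val : L → H)) :
    X₁.IsLoopBasis (Subtype.val : {a | S.half (Sum.inl a) ∈ L} → H₁) := by
  classical
  intro A _ p₁ hs₁ y₁
  let p' : Fin l → A := Pi.single ⟨0, hl⟩ (p₁ (Fin.last k))
  let p₂ : Fin (l + 1) → A := Fin.snoc (α := fun _ => A) p' (-p₁ (Fin.last k))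
  let p : Fin n → A := fun i => Sum.elim (fun i : Fin k => p₁ i.castSucc) p' (S.leg.symm i)
  have hp₁ : ∀ i, p (S.leg (Sum.inl i)) = p₁ i.castSucc := by simp [p]
  have hp₂ : ∀ i, p (S.leg (Sum.inr i)) = p₂ i.castSucc := by simp [p, p₂]
  have hs₂ : ∑ i, p₂ i = 0 := by simp [p₂, p', Fin.sum_univ_castSucc]
  have hs : ∑ i, p i = 0 := by
    rw [S.sum_leg, ← hs₁, Fin.sum_univ_castSucc]
    simp [p, p']
  let y : L → A := fun h =>
    Sum.elim (fun a => if ha : S.half (Sum.inl a) ∈ L then y₁ ⟨a, ha⟩ else 0) 0 (S.half.symm h)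
  obtain ⟨x, ⟨hx, hxy⟩, hu⟩ := hL A p hs y
  refine ⟨fun a => x (S.half (Sum.inl a)), ⟨g.conserves_left hp₁ hs₁ hx, ?_⟩, ?_⟩
  · rintro ⟨a, ha⟩
    have ha' : S.half (Sum.inl a) ∈ L := ha
    have := hxy ⟨_, ha'⟩
    simpa [y, ha'] using this
  · rintro x₁ ⟨hx₁, hxy₁⟩
    have := hu (fun h => Sum.elim x₁ (fun b => x (S.half (Sum.inr b))) (S.half.symm h)) ⟨?_, ?_⟩
    · rw [← this]
      simp
    · refine g.conserves_glue hp₁ hp₂ (by simp [p₂]) ?_ ?_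
      · simpa using hx₁
      · simpa using g.swap.conserves_left hp₂ hs₂ hx
    · rintro ⟨h, hh⟩
      rcases S.half_cases h with ⟨a, rfl⟩ | ⟨b, rfl⟩
      · simpa [y, hh] using hxy₁ ⟨a, hh⟩
      · simpa using hxy ⟨_, hh⟩

open Classical in
theorem edges_eq (g : IsGlue S X X₁ X₂) :
    X.edges = insert s(S.half (Sum.inl (X₁.leg (Fin.last k))),
        X.pair (S.half (Sum.inl (X₁.leg (Fin.last k)))))
      (X₁.edges.image (Sym2.map fun a => S.half (Sum.inl a)) ∪
        X₂.edges.image (Sym2.map fun b => S.half (Sum.inr b))) := by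
  ext z
  simp only [Finset.mem_insert, Finset.mem_union, Finset.mem_image, Wiring.mem_edges]
  constructor
  · rintro ⟨h, hh, rfl⟩
    rcases S.half_cases h with ⟨a, rfl⟩ | ⟨b, rfl⟩
    · rcases g.pair_inl_cases a with ⟨rfl, -, h3⟩ | ⟨h1, h2⟩
      · exact Or.inl rfl
      · refine Or.inr (Or.inl ⟨_, ⟨a, ?_, rfl⟩, ?_⟩)
        · rw [h2] at hh; simpa using hh
        · rw [h2]; rfl
    · rcases g.pair_inr_cases b with ⟨rfl, -, h3⟩ | ⟨h1, h2⟩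
      · left
        rw [h3, g.pair_last, Sym2.eq_swap]
      · refine Or.inr (Or.inr ⟨_, ⟨b, ?_, rfl⟩, ?_⟩)
        · rw [h2] at hh; simpa using hh
        · rw [h2]; rfl
  · rintro (rfl | ⟨_, ⟨a, ha, rfl⟩, rfl⟩ | ⟨_, ⟨b, hb, rfl⟩, rfl⟩)
    · exact ⟨_, by rw [g.pair_last]; simp, rfl⟩
    · have h2 := g.pair_left a (by rintro rfl; exact ha (X₁.pair_leg _))
      exact ⟨S.half (Sum.inl a), by rw [h2]; simpa using ha, by rw [h2]; rfl⟩
    · have h2 := g.pair_right b (by rintro rfl; exact hb (X₂.pair_leg _))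
      exact ⟨S.half (Sum.inr b), by rw [h2]; simpa using hb, by rw [h2]; rfl⟩

variable [Fintype V] [Fintype V₁] [Fintype V₂]
  {W : V → ℤˣ → (H → Momentum D) → ℂ} {W₁ : V₁ → ℤˣ → (H₁ → Momentum D) → ℂ}
  {W₂ : V₂ → ℤˣ → (H₂ → Momentum D) → ℂ} {G : ℤˣ → ℤˣ → Momentum D → ℂ}

theorem integrand_eq (hG : ∀ a b q, G a b (-q) = G b a q)
    (hW₁ : ∀ v a x, W (S.vert (Sum.inl v)) a x = W₁ v a fun h => x (S.half (Sum.inl h)))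
    (hW₂ : ∀ v a x, W (S.vert (Sum.inr v)) a x = W₂ v a fun h => x (S.half (Sum.inr h)))
    (hε₁ : ε₁ (Fin.last k) = 1) (hε₂ : ε₂ (Fin.last l) = 1) (g : IsGlue S X X₁ X₂)
    {p : Fin n → Momentum D} {p₁ : Fin (k + 1) → Momentum D} {p₂ : Fin (l + 1) → Momentum D}
    {x : H → Momentum D} (hx : X.Conserves p x)
    (hx₁ : X₁.Conserves p₁ fun a => x (S.half (Sum.inl a)))
    (hx₂ : X₂.Conserves p₂ fun b => x (S.half (Sum.inr b))) :
    X.integrand W G x = G 1 1 (p₁ (Fin.last k)) *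
      (X₁.integrand W₁ G (fun a => x (S.half (Sum.inl a))) *
        X₂.integrand W₂ G (fun b => x (S.half (Sum.inr b)))) := by
  classical
  have e₁ : ∀ i, x (S.half (Sum.inl (X₁.leg i))) = p₁ i := hx₁.1
  have hv : ∏ v, W v (X.sign v) x =
      (∏ v, W₁ v (X₁.sign v) fun a => x (S.half (Sum.inl a))) *
        ∏ v, W₂ v (X₂.sign v) fun b => x (S.half (Sum.inr b)) := by
    rw [← S.vert.prod_comp, Fintype.prod_sum_type]
    simp only [hW₁, hW₂, g.sign_left, g.sign_right]
  have hinj₁ : Function.Injective (Sym2.map fun a => S.half (Sum.inl a)) :=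
    Sym2.map.injective (half_inl_injective S)
  have hinj₂ : Function.Injective (Sym2.map fun b => S.half (Sum.inr b)) :=
    Sym2.map.injective (half_inl_injective S.swap)
  have hdisj : Disjoint (X₁.edges.image (Sym2.map fun a => S.half (Sum.inl a)))
      (X₂.edges.image (Sym2.map fun b => S.half (Sum.inr b))) := by
    rw [Finset.disjoint_left]
    intro z h1 h2
    obtain ⟨z₁, -, rfl⟩ := Finset.mem_image.1 h1
    obtain ⟨z₂, -, h⟩ := Finset.mem_image.1 h2
    induction z₁ with | _ a a'
    induction z₂ with | _ b b'
    simp at h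
  have hnot : s(S.half (Sum.inl (X₁.leg (Fin.last k))),
        X.pair (S.half (Sum.inl (X₁.leg (Fin.last k))))) ∉
      X₁.edges.image (Sym2.map fun a => S.half (Sum.inl a)) ∪
        X₂.edges.image (Sym2.map fun b => S.half (Sum.inr b)) := by
    rw [g.pair_last]
    intro h
    rcases Finset.mem_union.1 h with h | h
    · obtain ⟨z, -, h⟩ := Finset.mem_image.1 h
      induction z with | _ a a'
      simp at h
    · obtain ⟨z, -, h⟩ := Finset.mem_image.1 h
      induction z with | _ a a'
      simp at h
  have he : ∏ z ∈ X.edges, X.edgeFactor G x z = G 1 1 (p₁ (Fin.last k)) *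
      ((∏ z ∈ X₁.edges, X₁.edgeFactor G (fun a => x (S.half (Sum.inl a))) z) *
        ∏ z ∈ X₂.edges, X₂.edgeFactor G (fun b => x (S.half (Sum.inr b))) z) := by
    rw [g.edges_eq, Finset.prod_insert hnot, Finset.prod_union hdisj,
      Finset.prod_image hinj₁.injOn, Finset.prod_image hinj₂.injOn,
      Wiring.edgeFactor_mk hG hx (by rw [g.pair_last]; simp), g.pair_last, S.root_inl, S.root_inr,
      g.sign_left, g.sign_right, X₁.sign_leg, X₂.sign_leg, hε₁, hε₂, e₁]
    congr 2
    · exact Finset.prod_congr rfl fun z hz => g.edgeFactor_left hG hx hx₁ hz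
    · exact Finset.prod_congr rfl fun z hz => g.swap.edgeFactor_left hG hx hx₂ hz
  rw [Wiring.integrand, Wiring.integrand, Wiring.integrand, hv, he]
  ring

/-- The Feynman integral of a diagram factorizes at a joining edge. -/
theorem value_eq (hk : 0 < k) (hl : 0 < l) (hG : ∀ a b q, G a b (-q) = G b a q)
    (hW₁ : ∀ v a x, W (S.vert (Sum.inl v)) a x = W₁ v a fun h => x (S.half (Sum.inl h)))
    (hW₂ : ∀ v a x, W (S.vert (Sum.inr v)) a x = W₂ v a fun h => x (S.half (Sum.inr h)))
    (hε₁ : ε₁ (Fin.last k) = 1) (hε₂ : ε₂ (Fin.last l) = 1) (g : IsGlue S X X₁ X₂)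
    {p : Fin n → Momentum D} {p₁ : Fin (k + 1) → Momentum D} {p₂ : Fin (l + 1) → Momentum D}
    (hp₁ : ∀ i, p (S.leg (Sum.inl i)) = p₁ i.castSucc)
    (hp₂ : ∀ j, p (S.leg (Sum.inr j)) = p₂ j.castSucc)
    (hs₁ : ∑ i, p₁ i = 0) (hs₂ : ∑ i, p₂ i = 0)
    (hlast : p₂ (Fin.last l) = - p₁ (Fin.last k)) :
    X.value W G p = G 1 1 (p₁ (Fin.last k)) * (X₁.value W₁ G p₁ * X₂.value W₂ G p₂) := by
  classical
  -- If a part has no loop basis, neither has the whole, and both sides are `0`.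
  by_cases hL₁ : ∃ L : Set H₁, X₁.IsLoopBasis (Subtype.val : L → H₁)
  swap
  · have : ¬ ∃ L : Set H, X.IsLoopBasis (Subtype.val : L → H) :=
      fun ⟨L, hL⟩ => hL₁ ⟨_, g.isLoopBasis_left hl hL⟩
    rw [Wiring.value, dif_neg this, Wiring.value, dif_neg hL₁]
    simp
  by_cases hL₂ : ∃ L : Set H₂, X₂.IsLoopBasis (Subtype.val : L → H₂)
  swap
  · have : ¬ ∃ L : Set H, X.IsLoopBasis (Subtype.val : L → H) :=
      fun ⟨L, hL⟩ => hL₂ ⟨_, g.swap.isLoopBasis_left hk hL⟩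
    rw [Wiring.value, dif_neg this, Wiring.value, Wiring.value, dif_neg hL₂]
    simp
  obtain ⟨L₁, hL₁⟩ := hL₁
  obtain ⟨L₂, hL₂⟩ := hL₂
  have hs : ∑ i, p i = 0 := by
    rw [Fin.sum_univ_castSucc] at hs₁ hs₂
    simp only [← hp₁, ← hp₂] at hs₁ hs₂
    rw [S.sum_leg, eq_neg_of_add_eq_zero_left hs₁, eq_neg_of_add_eq_zero_left hs₂, hlast]
    simp
  choose x₁ hx₁ _ using fun y => hL₁ (Momentum D) p₁ hs₁ y
  choose x₂ hx₂ _ using fun y => hL₂ (Momentum D) p₂ hs₂ y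
  let x : (L₁ ⊕ L₂ → Momentum D) → H → Momentum D := fun y h =>
    Sum.elim (x₁ fun i => y (Sum.inl i)) (x₂ fun i => y (Sum.inr i)) (S.half.symm h)
  have hxl : ∀ y, (fun a => x y (S.half (Sum.inl a))) = x₁ fun i => y (Sum.inl i) := by
    intro y; funext a; simp [x]
  have hxr : ∀ y, (fun b => x y (S.half (Sum.inr b))) = x₂ fun i => y (Sum.inr i) := by
    intro y; funext a; simp [x]
  have hxc₁ : ∀ y, X₁.Conserves p₁ fun a => x y (S.half (Sum.inl a)) := fun y => by
    rw [hxl]; exact (hx₁ _).1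
  have hxc₂ : ∀ y, X₂.Conserves p₂ fun a => x y (S.half (Sum.inr a)) := fun y => by
    rw [hxr]; exact (hx₂ _).1
  have hx : ∀ y, X.Conserves p (x y) := fun y =>
    g.conserves_glue hp₁ hp₂ hlast (hxc₁ y) (hxc₂ y)
  rw [Wiring.value_eq hs (g.isLoopBasis_glue hL₁ hL₂), Wiring.value_eq hs₁ hL₁,
    Wiring.value_eq hs₂ hL₂,
    Wiring.loopIntegral_eq _ hs (g.isLoopBasis_glue hL₁ hL₂) hx ?_,
    Wiring.loopIntegral_eq _ hs₁ hL₁ (fun y => (hx₁ y).1) (fun y => (hx₁ y).2),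
    Wiring.loopIntegral_eq _ hs₂ hL₂ (fun y => (hx₂ y).1) (fun y => (hx₂ y).2)]
  · simp only [fun y => g.integrand_eq hG hW₁ hW₂ hε₁ hε₂ (hx y) (hxc₁ y) (hxc₂ y), hxl, hxr]
    -- For a product of functions of separate variables this form of Fubini requires no
    -- integrability, in accordance with the value `0` of divergent integrals.
    rw [integral_const_mul, ← integral_prod_mul, ← Measure.volume_eq_prod,
      ← (volume_measurePreserving_sumPiEquivProdPi
        fun _ : L₁ ⊕ L₂ => Momentum D).integral_comp']
    rfl
  · rintro y (i | i)
    · simpa [x] using (hx₁ _).2 i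
    · simpa [x] using (hx₂ _).2 i

end IsGlue

end GGreen

/-! ### Summation over diagrams, and counting of labellings -/

namespace GGreen

section Sum

variable {V H V₁ H₁ V₂ H₂ : Type*} [Fintype H]
  {r : H → V} {r₁ : H₁ → V₁} {r₂ : H₂ → V₂} {n k l : ℕ}
  {ε : Fin n → ℤˣ} {ε₁ : Fin (k + 1) → ℤˣ} {ε₂ : Fin (l + 1) → ℤˣ}

open Classical in
/-- The sum over all diagrams with a separating edge that has the first part on one side is the
product of the sums over the diagrams for the parts. -/
theorem sum_separates [Fintype (Wiring r ε)] [Fintype (Wiring r₁ ε₁)] [Fintype (Wiring r₂ ε₂)]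
    (S : Splitting r r₁ r₂ n k l)
    (hε₁ : ∀ i, ε (S.leg (Sum.inl i)) = ε₁ i.castSucc) (hlast₁ : ε₁ (Fin.last k) = 1)
    (hε₂ : ∀ j, ε (S.leg (Sum.inr j)) = ε₂ j.castSucc) (hlast₂ : ε₂ (Fin.last l) = 1)
    {Q : Wiring r ε → Prop} {Q₁ : Wiring r₁ ε₁ → Prop} {Q₂ : Wiring r₂ ε₂ → Prop}
    (hQ : ∀ X X₁ X₂, IsGlue S X X₁ X₂ → (X.Connected ∧ Q X ↔
      (X₁.Connected ∧ Q₁ X₁) ∧ X₂.Connected ∧ Q₂ X₂))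
    {F : Wiring r ε → ℂ} {F₁ : Wiring r₁ ε₁ → ℂ} {F₂ : Wiring r₂ ε₂ → ℂ} {c : ℂ}
    (hF : ∀ X X₁ X₂, IsGlue S X X₁ X₂ → F X = c * (F₁ X₁ * F₂ X₂)) :
    ∑ X : Wiring r ε, ∑ h : H,
      (if (X.Connected ∧ Q X) ∧ X.Separates S.leg h ∧ X.side h = S.left then F X else 0) =
    c * ((∑ X₁ : Wiring r₁ ε₁, if X₁.Connected ∧ Q₁ X₁ then F₁ X₁ else 0) *
      ∑ X₂ : Wiring r₂ ε₂, if X₂.Connected ∧ Q₂ X₂ then F₂ X₂ else 0) := by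
  choose J hJ using fun X : Wiring r₁ ε₁ × Wiring r₂ ε₂ =>
    exists_isGlue (ε := ε) S hε₁ hε₂ X.1 X.2
  rw [← Fintype.sum_prod_type', ← Finset.sum_filter, ← Finset.sum_filter, ← Finset.sum_filter,
    Finset.sum_mul_sum, ← Finset.sum_product', Finset.mul_sum]
  symm
  -- The bijection sends two parts to the joined diagram together with the half of the joining edge
  -- that lies in the first part.
  refine Finset.sum_bij (fun X _ => (J X, S.half (Sum.inl (X.1.leg (Fin.last k))))) ?_ ?_ ?_ ?_
  · rintro ⟨X₁, X₂⟩ hX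
    simp only [Finset.mem_product, Finset.mem_filter, Finset.mem_univ, true_and] at hX ⊢
    exact ⟨(hQ _ _ _ (hJ (X₁, X₂))).2 hX,
      (hJ (X₁, X₂)).separates hX.1.1 hX.2.1 hlast₁ hlast₂, (hJ (X₁, X₂)).side_left hX.1.1⟩
  · rintro ⟨X₁, X₂⟩ - ⟨Y₁, Y₂⟩ - h
    obtain ⟨h1, h2⟩ := Prod.mk.inj h
    have h3 : X₁.leg (Fin.last k) = Y₁.leg (Fin.last k) := IsGlue.half_inl_injective S h2
    have g := hJ (X₁, X₂)
    have g' := hJ (Y₁, Y₂)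
    rw [h1] at g
    exact Prod.ext (g.eq_left g' h3) (g.eq_right g' h3)
  · rintro ⟨X, h⟩ hX
    simp only [Finset.mem_filter, Finset.mem_univ, true_and] at hX
    obtain ⟨hc, hs, hside⟩ := hX
    obtain ⟨X₁, X₂, g, hh⟩ := hs.exists_isGlue hε₁ hlast₁ hε₂ hlast₂ hside
    refine ⟨(X₁, X₂), ?_, ?_⟩
    · simpa using (hQ _ _ _ g).1 hc
    · exact Prod.ext ((hJ (X₁, X₂)).unique g) hh.symm
  · rintro ⟨X₁, X₂⟩ -
    exact (hF _ _ _ (hJ (X₁, X₂))).symm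

end Sum

section Counting

variable {κ : Type*}

/-- The numbers of vertices of each kind in a set of vertices. -/
def count {m : κ →₀ ℕ} (A : Finset (Vert m)) : κ →₀ ℕ := ∑ v ∈ A, Finsupp.single (v.1 : κ) 1

theorem count_univ (m : κ →₀ ℕ) : count (Finset.univ : Finset (Vert m)) = m := by
  rw [count, Fintype.sum_sigma]
  simp only [Finset.sum_const, Finset.card_univ, Fintype.card_fin, Finsupp.smul_single,
    smul_eq_mul, mul_one]
  rw [Finset.sum_coe_sort m.support fun t => Finsupp.single t (m t)]
  exact m.sum_single

theorem count_add_count_compl {m : κ →₀ ℕ} [DecidableEq (Vert m)] (A : Finset (Vert m)) :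
    count A + count Aᶜ = m := by
  rw [count, count, Finset.sum_add_sum_compl]
  exact count_univ m

/-- The two sums record how many elements there are of each kind; equal fibres are matched kind by
kind. -/
theorem exists_equiv_of_sum_single_eq {α β : Type*} [Fintype α] [Fintype β] {f : α → κ}
    {g : β → κ} (h : ∑ a, Finsupp.single (f a) 1 = ∑ b, Finsupp.single (g b) 1) :
    ∃ e : α ≃ β, ∀ a, g (e a) = f a := by
  classical
  have hcard : ∀ t, Fintype.card {a // f a = t} = Fintype.card {b // g b = t} := by
    intro t
    have := DFunLike.congr_fun h t
    simpa [Finsupp.finsetSum_apply, Finsupp.single_apply, Fintype.card_subtype] using this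
  exact ⟨Equiv.ofFiberEquiv fun t => Fintype.equivOfCardEq (hcard t),
    fun a => Equiv.ofFiberEquiv_map _ a⟩

/-- The vertex to which a half-edge is attached. -/
abbrev root (d : κ → ℕ) (m : κ →₀ ℕ) (h : Half d m) : Vert m := h.1

/-- A bijection of vertices which preserves kinds acts on half-edges. -/
def halfEquiv (d : κ → ℕ) {m m₁ m₂ : κ →₀ ℕ} (e : Vert m₁ ⊕ Vert m₂ ≃ Vert m)
    (h₁ : ∀ v, ((e (Sum.inl v)).1 : κ) = v.1) (h₂ : ∀ v, ((e (Sum.inr v)).1 : κ) = v.1) :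
    Half d m₁ ⊕ Half d m₂ ≃ Half d m :=
  (Equiv.sumSigmaDistrib fun v : Vert m₁ ⊕ Vert m₂ =>
    Fin (Sum.elim (fun v => d v.1) (fun v => d v.1) v)).symm.trans
    (Equiv.sigmaCongr e fun v => finCongr (by
      rcases v with v | v
      · exact congrArg d (h₁ v).symm
      · exact congrArg d (h₂ v).symm))

/-- Relabels the vertices in `A` and outside it as standard vertex sets of diagrams with the counts
of `A` and `Aᶜ`. Half-edges keep their position at the vertex; the cast appears because kinds agree
only propositionally. -/
theorem exists_splitting (d : κ → ℕ) {m : κ →₀ ℕ} [DecidableEq (Vert m)] (A : Finset (Vert m))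
    (k l : ℕ) :
    ∃ S : Splitting (root d m) (root d (count A)) (root d (count Aᶜ)) (k + l) k l,
      S.leg = finSumFinEquiv ∧ S.left = A ∧
      (∀ v, ∃ h : d v.1 = d (S.vert (Sum.inl v)).1, (S.vert (Sum.inl v)).1.1 = v.1 ∧
        ∀ s, S.half (Sum.inl ⟨v, s⟩) = ⟨S.vert (Sum.inl v), Fin.cast h s⟩) ∧
      ∀ v, ∃ h : d v.1 = d (S.vert (Sum.inr v)).1, (S.vert (Sum.inr v)).1.1 = v.1 ∧
        ∀ s, S.half (Sum.inr ⟨v, s⟩) = ⟨S.vert (Sum.inr v), Fin.cast h s⟩ := by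
  obtain ⟨e₁, he₁⟩ := exists_equiv_of_sum_single_eq
    (f := fun v : Vert (count A) => (v.1 : κ)) (g := fun v : {v // v ∈ A} => (v.1.1 : κ)) (by
      rw [Finset.sum_coe_sort A fun v => Finsupp.single (v.1 : κ) 1]
      exact count_univ (count A))
  obtain ⟨e₂, he₂⟩ := exists_equiv_of_sum_single_eq
    (f := fun v : Vert (count Aᶜ) => (v.1 : κ)) (g := fun v : {v // v ∉ A} => (v.1.1 : κ)) (by
      rw [← Finset.sum_subtype Aᶜ (fun v => Finset.mem_compl)
        fun v => Finsupp.single (v.1 : κ) 1]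
      exact count_univ (count Aᶜ))
  let e : Vert (count A) ⊕ Vert (count Aᶜ) ≃ Vert m :=
    (Equiv.sumCongr e₁ e₂).trans (Equiv.sumCompl (· ∈ A))
  refine ⟨{
    vert := e
    half := halfEquiv d e he₁ he₂
    leg := finSumFinEquiv
    root_half := ?_ }, rfl, ?_, fun v => ⟨congrArg d (he₁ v).symm, he₁ v, fun s => rfl⟩,
      fun v => ⟨congrArg d (he₂ v).symm, he₂ v, fun s => rfl⟩⟩
  · rintro (h | h) <;> rfl
  · ext v
    constructor
    · rintro ⟨w, rfl⟩
      exact (e₁ w).2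
    · intro hv
      exact ⟨e₁.symm ⟨v, hv⟩, by simp [e]⟩

theorem count_eq_iff {m m₁ : κ →₀ ℕ} (h : m₁ ≤ m) (f : ∀ t : m.support, Finset (Fin (m t))) :
    count ((Finset.univ : Finset m.support).sigma f) = m₁ ↔ ∀ t : m.support, (f t).card = m₁ t := by
  classical
  have hc : count ((Finset.univ : Finset m.support).sigma f) =
      ∑ t : m.support, Finsupp.single (t : κ) (f t).card := by
    rw [count, Finset.sum_sigma]
    simp
  have hval : ∀ t : m.support, (∑ t : m.support, Finsupp.single (t : κ) (f t).card) (t : κ) =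
      (f t).card := by
    intro t
    rw [Finsupp.finsetSum_apply, Finset.sum_eq_single t]
    · simp
    · intro t' _ hne
      exact Finsupp.single_eq_of_ne (fun h => hne (Subtype.ext h.symm))
    · simp
  rw [hc]
  constructor
  · rintro rfl t
    exact (hval t).symm
  · intro hf
    ext t
    by_cases ht : t ∈ m.support
    · rw [hval ⟨t, ht⟩, hf]
    -- For kinds absent from `m`, the bound `m₁ ≤ m` forces `m₁ t = 0`.
    · have h0 : m t = 0 := Finsupp.notMem_support_iff.1 ht
      rw [Finsupp.finsetSum_apply, Finset.sum_eq_zero, eq_comm]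
      · exact Nat.eq_zero_of_le_zero (h0 ▸ h t)
      · intro t' _
        exact Finsupp.single_eq_of_ne (fun h => ht (h ▸ t'.2))

open Classical in
theorem card_count_eq {m m₁ : κ →₀ ℕ} (h : m₁ ≤ m) :
    (Finset.univ.filter fun A : Finset (Vert m) => count A = m₁).card =
      ∏ t ∈ m.support, (m t).choose (m₁ t) := by
  have hcard : (Fintype.piFinset fun t : m.support =>
      Finset.powersetCard (m₁ t) (Finset.univ : Finset (Fin (m t)))).card =
      ∏ t ∈ m.support, (m t).choose (m₁ t) := by
    simp only [Fintype.card_piFinset, Finset.card_powersetCard, Finset.card_univ,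
      Fintype.card_fin]
    exact Finset.prod_coe_sort m.support fun t => (m t).choose (m₁ t)
  rw [← hcard]
  have hA : ∀ A : Finset (Vert m), (Finset.univ : Finset m.support).sigma
      (fun t => Finset.univ.filter fun s => (⟨t, s⟩ : Vert m) ∈ A) = A := by
    intro A
    ext ⟨t, s⟩
    simp
  refine Finset.card_nbij' (fun A t => Finset.univ.filter fun s => (⟨t, s⟩ : Vert m) ∈ A)
    (fun f => Finset.univ.sigma f) ?_ ?_ ?_ ?_
  · intro A hAm
    have hA' := (Finset.mem_filter.1 hAm).2
    rw [← hA A, count_eq_iff h] at hA'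
    simpa [Finset.mem_powersetCard] using hA'
  · intro f hf
    have : ∀ t, (f t).card = m₁ t := by simpa [Finset.mem_powersetCard] using hf
    simpa using (count_eq_iff h f).2 this
  · intro A _
    exact hA A
  · intro f _
    funext t
    ext s
    simp

/-- For each kind the binomial coefficient times the two factorials is `(m₁ t + m₂ t)!`, and the
powers of `(d t)!` multiply. This is the multiplicativity of the symmetry factors. -/
theorem Theory.card_mul_labellings {D : ℕ} (T : Theory κ D) (m₁ m₂ : κ →₀ ℕ) :
    ((∏ t ∈ (m₁ + m₂).support, ((m₁ + m₂) t).choose (m₁ t) : ℕ) : ℂ) *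
      (T.labellings m₁ * T.labellings m₂) = T.labellings (m₁ + m₂) := by
  classical
  have hs₁ : m₁.support ⊆ (m₁ + m₂).support := by
    intro t ht
    simp only [Finsupp.mem_support_iff, Finsupp.add_apply] at ht ⊢
    omega
  have hs₂ : m₂.support ⊆ (m₁ + m₂).support := by
    intro t ht
    simp only [Finsupp.mem_support_iff, Finsupp.add_apply] at ht ⊢
    omega
  rw [labellings, labellings, labellings, Finsupp.prod_of_support_subset m₁ hs₁ _ (by simp),
    Finsupp.prod_of_support_subset m₂ hs₂ _ (by simp), Finsupp.prod, Nat.cast_prod,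
    ← Finset.prod_mul_distrib, ← Finset.prod_mul_distrib]
  refine Finset.prod_congr rfl fun t _ => ?_
  rw [← Nat.cast_mul, ← Nat.cast_mul, Finsupp.add_apply, Nat.choose_symm_add,
    ← Nat.add_choose_mul_factorial_mul_factorial (m₁ t) (m₂ t), pow_add]
  congr 1
  ring

theorem Theory.labellings_ne_zero {D : ℕ} (T : Theory κ D) (m : κ →₀ ℕ) : T.labellings m ≠ 0 :=
  Finset.prod_ne_zero_iff.2 fun _ _ => Nat.cast_ne_zero.2
    (Nat.mul_ne_zero (Nat.factorial_ne_zero _) (pow_ne_zero _ (Nat.factorial_ne_zero _)))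

end Counting

end GGreen

/-! ### From wirings back to Feynman diagrams and power series -/

namespace GGreen

variable {κ : Type*} {D : ℕ}

namespace Diagram

variable {d : κ → ℕ} {m : κ →₀ ℕ} {n : ℕ} {ε : Fin n → ℤˣ}

/-- Diagrams are wirings of the half-edges of their vertices. -/
def equivWiring : Diagram d m ε ≃ Wiring (root d m) ε where
  toFun X := ⟨X.sign, X.pair, X.leg, X.pair_pair, X.leg_injective, X.pair_eq_iff, X.sign_leg⟩
  invFun X := ⟨X.sign, X.pair, X.leg, X.pair_pair, X.leg_injective, X.pair_eq_iff, X.sign_leg⟩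
  left_inv _ := rfl
  right_inv _ := rfl

instance : Fintype (Wiring (root d m) ε) := Fintype.ofEquiv _ equivWiring

theorem conserves_iff {A : Type*} [AddCommGroup A] (X : Diagram d m ε) (p : Fin n → A)
    (x : Half d m → A) : (equivWiring X).Conserves p x ↔ X.Conserves p x := by
  classical
  refine and_congr Iff.rfl (and_congr Iff.rfl (forall_congr' fun v => ?_))
  have : ∑ h with root d m h = v, x h = ∑ s, x ⟨v, s⟩ := by
    rw [Finset.sum_filter, Fintype.sum_sigma, Fintype.sum_eq_single v]
    · simp
    · intro w hw
      simp [hw]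
  rw [← this]
  convert Iff.rfl

theorem isLoopBasis_iff (X : Diagram d m ε) (L : Set (Half d m)) :
    (equivWiring X).IsLoopBasis (Subtype.val : L → Half d m) ↔ X.IsLoopBasis L := by
  simp only [Wiring.IsLoopBasis, IsLoopBasis, conserves_iff]

theorem separates_iff {k l : ℕ} {ε : Fin (k + l) → ℤˣ} (X : Diagram d m ε) (h : Half d m) :
    X.Separates h ↔ (equivWiring X).Separates finSumFinEquiv h := by
  simp only [Separates, Wiring.Separates, finSumFinEquiv_apply_left, finSumFinEquiv_apply_right]
  rfl

theorem edges_equivWiring (X : Diagram d m ε) : (equivWiring X).edges = X.edges := by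
  classical
  ext z
  rw [Wiring.mem_edges]
  simp only [edges, Finset.mem_image, Finset.mem_filter, Finset.mem_univ, true_and]
  rfl

end Diagram

namespace Theory

variable (T : Theory κ D) {m : κ →₀ ℕ} {n : ℕ} {ε : Fin n → ℤˣ}

/-- The factor of a vertex as a function of the momenta of all half-edges. -/
def weight (m : κ →₀ ℕ) (v : Vert m) (a : ℤˣ) (x : Half T.valence m → Momentum D) : ℂ :=
  T.vertex v.1 a fun s => x ⟨v, s⟩

theorem value_eq_value (X : Diagram T.valence m ε) {p : Fin n → Momentum D}
    (hp : ∑ i, p i = 0) :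
    T.value X p = (Diagram.equivWiring X).value (T.weight m) T.propagator p := by
  classical
  by_cases hL : ∃ L, X.IsLoopBasis L
  · have hb := (X.isLoopBasis_iff _).2 hL.choose_spec
    choose x hx _ using fun y => hb (Momentum D) p hp y
    rw [value, dif_pos hL, Wiring.value_eq hp hb,
      Wiring.loopIntegral_eq _ hp hb (fun y => (hx y).1) (fun y => (hx y).2)]
    refine integral_congr_ae (Filter.Eventually.of_forall fun y => ?_)
    have hx' : X.Conserves p (x y) ∧ ∀ h : hL.choose, x y h = y h :=
      ⟨(X.conserves_iff _ _).1 (hx y).1, (hx y).2⟩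
    have hex : ∃ x : Half T.valence m → Momentum D,
        X.Conserves p x ∧ ∀ h : hL.choose, x h = y h := ⟨_, hx'⟩
    simp only [dif_pos hex]
    rw [(hL.choose_spec (Momentum D) p hp y).unique hex.choose_spec hx', integrand, Wiring.integrand,
      X.edges_equivWiring]
    rfl
  · have hL' : ¬ ∃ L : Set (Half T.valence m),
        (Diagram.equivWiring X).IsLoopBasis (Subtype.val : L → Half T.valence m) := by
      simpa only [Diagram.isLoopBasis_iff] using hL
    rw [value, dif_neg hL, Wiring.value, dif_neg hL']

theorem vertex_cast {t t' : κ} (h : t = t') (hd : T.valence t' = T.valence t) (a : ℤˣ)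
    (x : Fin (T.valence t) → Momentum D) :
    T.vertex t a x = T.vertex t' a fun s => x (Fin.cast hd s) := by
  subst h
  rfl

open Classical in
/-- The sum of the Feynman integrals of all connected labelled diagrams, those with self-energy
insertions being excluded if `P` holds. -/
def labelledSum (P : Prop) (m : κ →₀ ℕ) (ε : Fin n → ℤˣ) (p : Fin n → Momentum D) : ℂ :=
  ∑ X : Diagram T.valence m ε,
    if X.Connected ∧ (P → X.NoSelfEnergy) then T.value X p else 0

open Classical in
theorem labelledSum_eq (P : Prop) {p : Fin n → Momentum D} (hp : ∑ i, p i = 0) :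
    T.labelledSum P m ε p = ∑ X : Wiring (root T.valence m) ε,
      if X.Connected ∧ (P → X.NoSelfEnergy) then X.value (T.weight m) T.propagator p else 0 := by
  rw [labelledSum, ← Diagram.equivWiring.sum_comp]
  refine Finset.sum_congr rfl fun X _ => ?_
  rw [T.value_eq_value X hp]
  rfl

variable {k l : ℕ} {ε : Fin k → ℤˣ} {ε' : Fin l → ℤˣ} {p : Fin k → Momentum D}
  {p' : Fin l → Momentum D}

open Classical in
/-- The diagrams in which a separating edge has the vertices `A` on the side of the first legs. -/
theorem sum_separates_side (hk : 0 < k) (hl : 0 < l) (hp : ∑ i, p i + ∑ j, p' j = 0) (P : Prop)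
    (A : Finset (Vert m)) :
    (∑ X : Wiring (root T.valence m) (Fin.append ε ε'), ∑ h : Half T.valence m,
      if (X.Connected ∧ (P → X.NoSelfEnergy)) ∧ X.Separates finSumFinEquiv h ∧ X.side h = A then
        X.value (T.weight m) T.propagator (Fin.append p p') else 0) =
    T.propagator 1 1 (-∑ i, p i) *
      (T.labelledSum P (count A) (Fin.snoc ε 1 : Fin (k + 1) → ℤˣ)
          (Fin.snoc p (-∑ i, p i) : Fin (k + 1) → Momentum D) *
        T.labelledSum P (count Aᶜ) (Fin.snoc ε' 1 : Fin (l + 1) → ℤˣ)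
          (Fin.snoc p' (-(-∑ i, p i)) : Fin (l + 1) → Momentum D)) := by
  obtain ⟨S, hleg, hleft, hS₁, hS₂⟩ := exists_splitting T.valence A k l
  have hs₁ : ∑ i, (Fin.snoc p (-∑ i, p i) : Fin (k + 1) → Momentum D) i = 0 := by
    simp [Fin.sum_univ_castSucc]
  have hs₂ : ∑ i, (Fin.snoc p' (-(-∑ i, p i)) : Fin (l + 1) → Momentum D) i = 0 := by
    simpa [Fin.sum_univ_castSucc, add_comm] using hp
  rw [T.labelledSum_eq P hs₁, T.labelledSum_eq P hs₂, ← hleg, ← hleft]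
  have key := sum_separates S (ε := Fin.append ε ε')
    (ε₁ := (Fin.snoc ε 1 : Fin (k + 1) → ℤˣ)) (ε₂ := (Fin.snoc ε' 1 : Fin (l + 1) → ℤˣ))
    (by simp [hleg]) (by simp) (by simp [hleg]) (by simp)
    (Q := fun X => P → X.NoSelfEnergy) (Q₁ := fun X => P → X.NoSelfEnergy)
    (Q₂ := fun X => P → X.NoSelfEnergy)
    (F := fun X => X.value (T.weight m) T.propagator (Fin.append p p'))
    (F₁ := fun X => X.value (T.weight (count A)) T.propagator
      (Fin.snoc p (-∑ i, p i) : Fin (k + 1) → Momentum D))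
    (F₂ := fun X => X.value (T.weight (count Aᶜ)) T.propagator
      (Fin.snoc p' (-(-∑ i, p i)) : Fin (l + 1) → Momentum D))
    (c := T.propagator 1 1 (-∑ i, p i)) ?_ ?_
  · convert key
  · intro X X₁ X₂ g
    by_cases hX : X.Connected
    · have hX' := g.connected_iff.1 hX
      have := g.noSelfEnergy_iff hk hl hX
      rw [this, imp_and]
      tauto
    · have hX' := mt g.connected_iff.2 hX
      tauto
  · intro X X₁ X₂ g
    have := g.value_eq (W := T.weight m) (W₁ := T.weight (count A)) (W₂ := T.weight (count Aᶜ))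
      hk hl T.propagator_symm ?_ ?_ (by simp) (by simp) (p := Fin.append p p')
      (p₁ := (Fin.snoc p (-∑ i, p i) : Fin (k + 1) → Momentum D))
      (p₂ := (Fin.snoc p' (-(-∑ i, p i)) : Fin (l + 1) → Momentum D))
      (by simp [hleg]) (by simp [hleg]) hs₁ hs₂ (by simp)
    · simpa using this
    · intro v a x
      obtain ⟨hd, ht, hh⟩ := hS₁ v
      simp only [weight, hh]
      exact T.vertex_cast ht hd a _
    · intro v a x
      obtain ⟨hd, ht, hh⟩ := hS₂ v
      simp only [weight, hh]
      exact T.vertex_cast ht hd a _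

open Classical in
/-- The sum over all diagrams and over all separating edges in them. -/
theorem sum_ncard_separates (hk : 0 < k) (hl : 0 < l) (hp : ∑ i, p i + ∑ j, p' j = 0)
    (P : Prop) :
    (∑ X : Diagram T.valence m (Fin.append ε ε'),
      ((if X.Connected ∧ (P → X.NoSelfEnergy) then {h | X.Separates h}.ncard else 0 : ℕ) : ℂ) *
        T.value X (Fin.append p p')) =
    ∑ A : Finset (Vert m), T.propagator 1 1 (-∑ i, p i) *
      (T.labelledSum P (count A) (Fin.snoc ε 1 : Fin (k + 1) → ℤˣ)
          (Fin.snoc p (-∑ i, p i) : Fin (k + 1) → Momentum D) *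
        T.labelledSum P (count Aᶜ) (Fin.snoc ε' 1 : Fin (l + 1) → ℤˣ)
          (Fin.snoc p' (-(-∑ i, p i)) : Fin (l + 1) → Momentum D)) := by
  have hs : ∑ i, Fin.append p p' i = 0 := by simpa [Fin.sum_univ_add] using hp
  simp only [← T.sum_separates_side hk hl hp P]
  rw [Finset.sum_comm, ← Diagram.equivWiring.sum_comp]
  refine Finset.sum_congr rfl fun X _ => ?_
  rw [Finset.sum_comm, T.value_eq_value X hs]
  -- A half-edge `h` contributes for exactly one `A`, the set of vertices on its side.
  have hinner : ∀ h : Half T.valence m, (∑ A : Finset (Vert m),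
      if ((Diagram.equivWiring X).Connected ∧ (P → (Diagram.equivWiring X).NoSelfEnergy)) ∧
        (Diagram.equivWiring X).Separates finSumFinEquiv h ∧
        (Diagram.equivWiring X).side h = A then
        (Diagram.equivWiring X).value (T.weight m) T.propagator (Fin.append p p') else 0) =
      if (X.Connected ∧ (P → X.NoSelfEnergy)) ∧ X.Separates h then
        (Diagram.equivWiring X).value (T.weight m) T.propagator (Fin.append p p') else 0 := by
    intro h
    rw [Finset.sum_eq_single ((Diagram.equivWiring X).side h).toFinset]
    · simp only [Set.coe_toFinset, and_true, X.separates_iff]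
      rfl
    · intro A _ hA
      rw [if_neg]
      rintro ⟨-, -, h'⟩
      exact hA (by simp [h'])
    · simp
  simp only [hinner]
  by_cases hX : X.Connected ∧ (P → X.NoSelfEnergy)
  · simp only [eq_true hX, true_and, if_true]
    rw [← Finset.sum_filter, Finset.sum_const, nsmul_eq_mul, Set.ncard_eq_toFinset_card']
    simp
  · simp [hX]

open Classical in
/-- The sum over diagrams and separating edges, with the labellings divided out, is the product of
the sums for the two parts. -/
theorem sum_ncard_separates_div (hk : 0 < k) (hl : 0 < l) (hp : ∑ i, p i + ∑ j, p' j = 0)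
    (P : Prop) :
    (∑ X : Diagram T.valence m (Fin.append ε ε'),
      ((if X.Connected ∧ (P → X.NoSelfEnergy) then {h | X.Separates h}.ncard else 0 : ℕ) : ℂ) *
        T.value X (Fin.append p p')) / T.labellings m =
    T.propagator 1 1 (-∑ i, p i) *
      ∑ μ ∈ Finset.HasAntidiagonal.antidiagonal m,
        T.labelledSum P μ.1 (Fin.snoc ε 1 : Fin (k + 1) → ℤˣ)
          (Fin.snoc p (-∑ i, p i) : Fin (k + 1) → Momentum D) / T.labellings μ.1 *
        (T.labelledSum P μ.2 (Fin.snoc ε' 1 : Fin (l + 1) → ℤˣ)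
          (Fin.snoc p' (-(-∑ i, p i)) : Fin (l + 1) → Momentum D) / T.labellings μ.2) := by
  rw [T.sum_ncard_separates hk hl hp P, ← Finset.mul_sum, mul_div_assoc]
  congr 1
  rw [← Finset.sum_fiberwise_of_maps_to (t := Finset.HasAntidiagonal.antidiagonal m)
    (g := fun A => (count A, count Aᶜ))
    (fun A _ => Finset.HasAntidiagonal.mem_antidiagonal.2 (count_add_count_compl A)), Finset.sum_div]
  refine Finset.sum_congr rfl ?_
  rintro ⟨m₁, m₂⟩ hμ
  obtain rfl : m₁ + m₂ = m := Finset.HasAntidiagonal.mem_antidiagonal.1 hμ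
  -- The total being fixed, the count of `A` determines that of its complement.
  have hfilter : (Finset.univ.filter fun A : Finset (Vert (m₁ + m₂)) =>
      (count A, count Aᶜ) = (m₁, m₂)) = Finset.univ.filter fun A => count A = m₁ := by
    refine Finset.filter_congr fun A _ => ?_
    rw [Prod.mk.injEq, and_iff_left_iff_imp]
    rintro h
    have := count_add_count_compl A
    rw [h] at this
    exact add_left_cancel this
  have hconst : ∀ A ∈ Finset.univ.filter fun A : Finset (Vert (m₁ + m₂)) =>
      (count A, count Aᶜ) = (m₁, m₂),
      T.labelledSum P (count A) (Fin.snoc ε 1 : Fin (k + 1) → ℤˣ)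
          (Fin.snoc p (-∑ i, p i) : Fin (k + 1) → Momentum D) *
        T.labelledSum P (count Aᶜ) (Fin.snoc ε' 1 : Fin (l + 1) → ℤˣ)
          (Fin.snoc p' (-(-∑ i, p i)) : Fin (l + 1) → Momentum D) =
      T.labelledSum P m₁ (Fin.snoc ε 1 : Fin (k + 1) → ℤˣ)
          (Fin.snoc p (-∑ i, p i) : Fin (k + 1) → Momentum D) *
        T.labelledSum P m₂ (Fin.snoc ε' 1 : Fin (l + 1) → ℤˣ)
          (Fin.snoc p' (-(-∑ i, p i)) : Fin (l + 1) → Momentum D) := by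
    intro A hA
    obtain ⟨h1, h2⟩ := Prod.mk.inj (Finset.mem_filter.1 hA).2
    rw [h1, h2]
  -- All `A` with the same counts contribute equally; their number cancels against the quotient of
  -- the labellings.
  rw [Finset.sum_congr rfl hconst, hfilter, Finset.sum_const, card_count_eq le_self_add,
    nsmul_eq_mul, ← T.card_mul_labellings m₁ m₂]
  have h0 := T.labellings_ne_zero (m₁ + m₂)
  rw [← T.card_mul_labellings m₁ m₂] at h0
  have h1 := left_ne_zero_of_mul h0
  have h2 := T.labellings_ne_zero m₁
  have h3 := T.labellings_ne_zero m₂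
  rw [mul_div_mul_left _ _ h1, div_mul_div_comm]

theorem coeff_green (m : κ →₀ ℕ) {n : ℕ} (ε : Fin n → ℤˣ) (p : Fin n → Momentum D) :
    MvPowerSeries.coeff m (T.green ε p) = T.labelledSum True m ε p / T.labellings m := by
  change T.diagramSum p _ = _
  rw [diagramSum, labelledSum]
  congr 1
  refine Finset.sum_congr rfl fun X _ => ?_
  by_cases h : X.Connected ∧ X.NoSelfEnergy
  · simp [h]
  · simp [h]

theorem coeff_greenAll (m : κ →₀ ℕ) {n : ℕ} (ε : Fin n → ℤˣ) (p : Fin n → Momentum D) :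
    MvPowerSeries.coeff m (T.greenAll ε p) = T.labelledSum False m ε p / T.labellings m := by
  change T.diagramSum p _ = _
  rw [diagramSum, labelledSum]
  congr 1
  refine Finset.sum_congr rfl fun X _ => ?_
  by_cases h : X.Connected
  · simp [h]
  · simp [h]

end Theory

/-- Without self-energy insertions the number of separating edges is at most one. -/
theorem Diagram.ncard_separates {d : κ → ℕ} {m : κ →₀ ℕ} {k l : ℕ} (hk : 0 < k) (hl : 0 < l)
    {ε : Fin (k + l) → ℤˣ} {X : Diagram d m ε} (hX : X.NoSelfEnergy)
    [Decidable (∃ h, X.Separates h)] :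
    {h | X.Separates h}.ncard = if ∃ h, X.Separates h then 1 else 0 := by
  split_ifs with h
  · obtain ⟨h, hh⟩ := h
    rw [Set.ncard_eq_one]
    refine ⟨h, Set.eq_singleton_iff_unique_mem.2 ⟨hh, fun h' hh' => ?_⟩⟩
    exact Wiring.NoSelfEnergy.separates_unique (X := equivWiring X) hk hl hX ((X.separates_iff _).1 hh')
      ((X.separates_iff _).1 hh)
  · rw [Set.ncard_eq_zero]
    exact Set.eq_empty_of_forall_notMem fun h' hh' => h ⟨h', hh'⟩

end GGreen

end

/-- Writing a full GGreen function as `δ(p₁ + ⋯ + pₙ)` times a function, the integral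
`∫ dq G₊₊(q) Ĝ(p, q) Ĝ(p', -q)` contains `δ(∑ p + q) δ(∑ p' - q)`; the first factor with `dq` is
the Dirac measure at `-∑ p`, and what is left of the second is the overall `δ(∑ p + ∑ p')`. -/
theorem lemma1 {κ : Type*} {D : ℕ} (T : GGreen.Theory κ D) {k l : ℕ} (hk : 0 < k) (hl : 0 < l)
    (ε : Fin k → ℤˣ) (ε' : Fin l → ℤˣ)
    (p : Fin k → GGreen.Momentum D) (p' : Fin l → GGreen.Momentum D)
    (hp : ∑ i, p i + ∑ j, p' j = 0) (m : κ →₀ ℕ) :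
    MvPowerSeries.coeff m (T.greenSep (Fin.append ε ε') (Fin.append p p')) =
        ∫ q : GGreen.Momentum D, T.propagator 1 1 q *
          MvPowerSeries.coeff m
            (T.green (Fin.snoc ε 1 : Fin (k + 1) → ℤˣ)
                (Fin.snoc p q : Fin (k + 1) → GGreen.Momentum D) *
              T.green (Fin.snoc ε' 1 : Fin (l + 1) → ℤˣ)
                (Fin.snoc p' (-q) : Fin (l + 1) → GGreen.Momentum D))
          ∂(MeasureTheory.Measure.dirac (-∑ i, p i)) ∧
      MvPowerSeries.coeff m (T.greenAllSep (Fin.append ε ε') (Fin.append p p')) =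
        ∫ q : GGreen.Momentum D, T.propagator 1 1 q *
          MvPowerSeries.coeff m
            (T.greenAll (Fin.snoc ε 1 : Fin (k + 1) → ℤˣ)
                (Fin.snoc p q : Fin (k + 1) → GGreen.Momentum D) *
              T.greenAll (Fin.snoc ε' 1 : Fin (l + 1) → ℤˣ)
                (Fin.snoc p' (-q) : Fin (l + 1) → GGreen.Momentum D))
          ∂(MeasureTheory.Measure.dirac (-∑ i, p i)) := by
  classical
  constructor
  -- The Dirac measure puts `q = -∑ i, p i`, and the coefficient of a product is a sum over the ways
  -- to distribute the vertices `m` between the two factors.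
  · rw [integral_dirac, MvPowerSeries.coeff_mul]
    simp only [GGreen.Theory.coeff_green]
    rw [← T.sum_ncard_separates_div hk hl hp True]
    change T.diagramSum _ _ = _
    rw [GGreen.Theory.diagramSum]
    congr 1
    refine Finset.sum_congr rfl fun X _ => ?_
    congr 2
    -- Having a separating edge and the number of separating edges agree as weights, since that
    -- number is at most one here.
    by_cases hc : X.Connected
    · by_cases hn : X.NoSelfEnergy
      · simp [hc, hn, GGreen.Diagram.ncard_separates hk hl hn]
      · simp [hc, hn]
    · simp [hc]
  · rw [integral_dirac, MvPowerSeries.coeff_mul]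
    simp only [GGreen.Theory.coeff_greenAll]
    rw [← T.sum_ncard_separates_div hk hl hp False]
    change T.diagramSum _ _ = _
    rw [GGreen.Theory.diagramSum]
    congr 1
    refine Finset.sum_congr rfl fun X _ => ?_
    congr 2
    simp
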